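/- Let $K$ be a field and let $\mathcal C$ be an additive $K$-category in which idempotents split. Assume that $\mathcal C$ is Krull–Schmidt (every object is a finite direct sum of objects with local endomorphism ring). Let $\operatorname{rad}$ be the radical of $\mathcal C$: $\operatorname{rad}(X,Y)$ consists of the $f\colon X\to Y$ such that $gf$ lies in the Jacobson radical of $\operatorname{End}(X)$ for all $g\colon Y\to X$. Its powers $\operatorname{rad}^i$ ($\operatorname{rad}^0=\operatorname{Hom}$) consist of the finite sums of $i$-fold composites of radical maps. Assume that $\mathcal C$ is locally radical finite: $\operatorname{rad}^i(X,Y)/\operatorname{rad}^{i+1}(X,Y)$ is finite dimensional over $K$ for all $X,Y$ and all $i\ge 0$. Let $\operatorname{Mod}(\mathcal C)$ be the category of $K$-linear functors $\mathcal C^{\mathrm{op}}\to\operatorname{Mod}K$. For $F$ in $\operatorname{Mod}(\mathcal C)$ define the subfunctor $\operatorname{rad}^iF$ of $F$ by $(\operatorname{rad}^iF)(X)=\sum_{f\in\operatorname{rad}^i(X,Y),\,Y\in\mathcal C}F(f)(F(Y))$. A functor $F$ in $\operatorname{Mod}(\mathcal C)$ is *weakly Koszul* if it has a resolution $\cdots\to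 P_1\to P_0\to F\to 0$ by finitely generated projective objects of $\operatorname{Mod}(\mathcal C)$ such that, with $\Omega^{j+1}(F)\subseteq P_j$ the kernel of the map $P_j\to P_{j-1}$ (where $P_{-1}=F$), $$\operatorname{rad}^{i+1}P_j\cap\Omega^{j+1}(F)=\operatorname{rad}^i\Omega^{j+1}(F)\qquad\text{for all } j\ge 0,\ i\ge 1 .$$ The category $\mathcal C$ is *weakly Koszul* if every simple functor in $\operatorname{Mod}(\mathcal C)$ is weakly Koszul. The *associated graded category* $\mathcal A_{\mathrm{gr}}(\mathcal C)$ has the same objects as $\mathcal C$, morphism spaces $\bigoplus_{i\ge 0}\operatorname{rad}^i(X,Y)/\operatorname{rad}^{i+1}(X,Y)$ with the evident grading, and the composition induced by that of $\mathcal C$. For $F$ in $\operatorname{Mod}(\mathcal C)$, $G(F)=\bigoplus_{i\ge 0}\operatorname{rad}^iF/\operatorname{rad}^{i+1}F$ is a graded functor on $\mathcal A_{\mathrm{gr}}(\mathcal C)$. Let $\mathcal D$ be a graded $K$-category that is positively graded, Krull–Schmidt (finite direct sums exist, and every object is a finite direct sum of objects $Y$ with $\operatorname{End}(Y)_0$ local,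 where the structure maps of the direct sums have degree $0$) and locally finite (each $\operatorname{Hom}(X,Y)_i$ is finite dimensional). With the convention $M[k]_j=M_{k+j}$, a $\mathbb Z$-graded functor $M$ from $\mathcal D^{\mathrm{op}}$ to graded $K$-vector spaces is *linear* if there are objects $X_n$ of $\mathcal D$ and an exact sequence $$\cdots\to\operatorname{Hom}_{\mathcal D}(-,X_2)[-2]\to\operatorname{Hom}_{\mathcal D}(-,X_1)[-1]\to\operatorname{Hom}_{\mathcal D}(-,X_0)\to M\to 0$$ with morphisms of degree $0$; and $\mathcal D$ is *Koszul* if every simple graded functor is linear up to shift (that is, some shift of it is linear). Then: 1. $\mathcal A_{\mathrm{gr}}(\mathcal C)$ is positively graded, Krull–Schmidt and locally finite. 2. If $F$ in $\operatorname{Mod}(\mathcal C)$ is weakly Koszul, then $G(F)$ is a linear functor over $\mathcal A_{\mathrm{gr}}(\mathcal C)$. 3. If $\mathcal C$ is weakly Koszul, then $\mathcal A_{\mathrm{gr}}(\mathcal C)$ is Koszul. -/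

import Mathlib

open CategoryTheory Opposite DirectSum

universe w v u

noncomputable section

namespace KoszulCat

/-! ## Associated graded vector spaces of filtered vector spaces -/

section Filtered

variable {K : Type w} [Field K]
variable {A B M N : Type v} [AddCommGroup A] [Module K A] [AddCommGroup B] [Module K B]
  [AddCommGroup M] [Module K M] [AddCommGroup N] [Module K N]

/-- The quotient `V i / V (i + 1)` (that is, `V i` modulo `V i ⊓ V (i + 1)`; all the filtrations
used below are decreasing). -/
abbrev GrPiece (V : ℕ → Submodule K A) (i : ℕ) : Type v :=
  (V i) ⧸ (V (i + 1)).submoduleOf (V i)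

/-- The associated graded vector space `⨁_{i ≥ 0} V i / V (i + 1)`. -/
abbrev GrMod (V : ℕ → Submodule K A) : Type v :=
  ⨁ i : ℕ, GrPiece V i

/-- The residue class, in degree `i`, of an element of `V i`. -/
def GrMod.mk (V : ℕ → Submodule K A) (i : ℕ) : V i →ₗ[K] GrMod V :=
  DirectSum.lof K ℕ (GrPiece V) i ∘ₗ Submodule.mkQ _

theorem GrMod.mk_congr (V : ℕ → Submodule K A) {i j : ℕ} (h : i = j) {a b : A}
    (ha : a ∈ V i) (hb : b ∈ V j) (hab : a = b) :
    GrMod.mk V i ⟨a, ha⟩ = GrMod.mk V j ⟨b, hb⟩ := by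
  subst h; subst hab; rfl

theorem GrMod.induction {V : ℕ → Submodule K A} {p : GrMod V → Prop} (x : GrMod V)
    (zero : p 0) (mk : ∀ (i : ℕ) (a : A) (ha : a ∈ V i), p (GrMod.mk V i ⟨a, ha⟩))
    (add : ∀ x y, p x → p y → p (x + y)) : p x := by
  induction x using DirectSum.induction_on with
  | zero => exact zero
  | of i y =>
    obtain ⟨⟨a, ha⟩, rfl⟩ := Submodule.mkQ_surjective _ y
    exact mk i a ha
  | add x y hx hy => exact add x y hx hy

/-- A bilinear map `β` with `β (V i) (W j) ⊆ U (i + j)` induces a bilinear map on pieces. -/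
def grPieceBilin (V : ℕ → Submodule K A) (W : ℕ → Submodule K B) (U : ℕ → Submodule K M)
    (β : A →ₗ[K] B →ₗ[K] M)
    (hβ : ∀ i j, ∀ a ∈ V i, ∀ b ∈ W j, β a b ∈ U (i + j)) (i j : ℕ) :
    GrPiece V i →ₗ[K] GrPiece W j →ₗ[K] GrPiece U (i + j) :=
  Submodule.liftQ _
    { toFun := fun a => Submodule.liftQ _
        (Submodule.mkQ ((U (i + j + 1)).submoduleOf (U (i + j))) ∘ₗ
          LinearMap.codRestrict (U (i + j)) (β a.1 ∘ₗ (W j).subtype)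
            (fun b => hβ i j a.1 a.2 b.1 b.2))
        (by
          intro b hb
          simp only [LinearMap.mem_ker, LinearMap.comp_apply, Submodule.mkQ_apply,
            Submodule.Quotient.mk_eq_zero]
          exact hβ i (j + 1) a.1 a.2 b.1 hb)
      map_add' := fun a a' => by
        refine Submodule.linearMap_qext _ (LinearMap.ext fun b => ?_)
        simp only [LinearMap.comp_apply, Submodule.mkQ_apply, Submodule.liftQ_apply,
          LinearMap.add_apply]
        rw [← Submodule.Quotient.mk_add]
        congr 1
        ext
        change β (a.1 + a'.1) b.1 = β a.1 b.1 + β a'.1 b.1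
        rw [map_add, LinearMap.add_apply]
      map_smul' := fun c a => by
        refine Submodule.linearMap_qext _ (LinearMap.ext fun b => ?_)
        simp only [LinearMap.comp_apply, Submodule.mkQ_apply, Submodule.liftQ_apply,
          LinearMap.smul_apply, RingHom.id_apply]
        rw [← Submodule.Quotient.mk_smul]
        congr 1
        ext
        change β (c • a.1) b.1 = c • β a.1 b.1
        rw [map_smul, LinearMap.smul_apply] }
    (by
      intro a ha
      rw [LinearMap.mem_ker]
      refine Submodule.linearMap_qext _ (LinearMap.ext fun b => ?_)
      simp only [LinearMap.comp_apply, Submodule.mkQ_apply, LinearMap.coe_mk, AddHom.coe_mk,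
        Submodule.liftQ_apply, LinearMap.zero_apply, Submodule.Quotient.mk_eq_zero]
      have := hβ (i + 1) j a.1 ha b.1 b.2
      rwa [show i + 1 + j = i + j + 1 by omega] at this)

/-- The bilinear map on associated graded vector spaces induced by `β`:
`(a mod V (i + 1), b mod W (j + 1)) ↦ β a b mod U (i + j + 1)`. -/
def grBilin (V : ℕ → Submodule K A) (W : ℕ → Submodule K B) (U : ℕ → Submodule K M)
    (β : A →ₗ[K] B →ₗ[K] M)
    (hβ : ∀ i j, ∀ a ∈ V i, ∀ b ∈ W j, β a b ∈ U (i + j)) :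
    GrMod V →ₗ[K] GrMod W →ₗ[K] GrMod U :=
  DirectSum.toModule K ℕ _ fun i =>
    LinearMap.flip (DirectSum.toModule K ℕ _ fun j =>
      LinearMap.flip ((grPieceBilin V W U β hβ i j).compr₂ (DirectSum.lof K ℕ _ (i + j))))

theorem grBilin_mk (V : ℕ → Submodule K A) (W : ℕ → Submodule K B) (U : ℕ → Submodule K M)
    (β : A →ₗ[K] B →ₗ[K] M)
    (hβ : ∀ i j, ∀ a ∈ V i, ∀ b ∈ W j, β a b ∈ U (i + j)) {i j : ℕ} {a : A} {b : B}
    (ha : a ∈ V i) (hb : b ∈ W j) :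
    grBilin V W U β hβ (GrMod.mk V i ⟨a, ha⟩) (GrMod.mk W j ⟨b, hb⟩) =
      GrMod.mk U (i + j) ⟨β a b, hβ i j a ha b hb⟩ := by
  simp only [grBilin, GrMod.mk, LinearMap.comp_apply, DirectSum.toModule_lof, LinearMap.flip_apply,
    LinearMap.compr₂_apply]
  rfl

/-- The homogeneous part of degree `n : ℤ` of the associated graded vector space; it is zero
for `n < 0`. -/
def grDeg (V : ℕ → Submodule K A) : ℤ → Submodule K (GrMod V)
  | Int.ofNat i => LinearMap.range (DirectSum.lof K ℕ (GrPiece V) i)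
  | Int.negSucc _ => ⊥

theorem mk_mem_grDeg (V : ℕ → Submodule K A) (i : ℕ) (a : V i) :
    GrMod.mk V i a ∈ grDeg V (i : ℤ) :=
  ⟨_, rfl⟩

theorem exists_of_mem_grDeg {V : ℕ → Submodule K A} {n : ℤ} {x : GrMod V} (hx : x ∈ grDeg V n) :
    x = 0 ∨ ∃ (i : ℕ) (a : A) (ha : a ∈ V i), n = i ∧ x = GrMod.mk V i ⟨a, ha⟩ := by
  cases n with
  | ofNat i =>
    obtain ⟨y, rfl⟩ := hx
    obtain ⟨⟨a, ha⟩, rfl⟩ := Submodule.mkQ_surjective _ y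
    exact Or.inr ⟨i, a, ha, rfl, rfl⟩
  | negSucc i => exact Or.inl hx

theorem grDeg_isInternal (V : ℕ → Submodule K A) : DirectSum.IsInternal (grDeg V) := by
  classical
  -- projection onto a homogeneous part
  have key : ∀ n : ℤ, ∃ π : GrMod V →ₗ[K] GrMod V,
      (∀ x ∈ grDeg V n, π x = x) ∧ ∀ m ≠ n, ∀ x ∈ grDeg V m, π x = 0 := by
    intro n
    cases n with
    | ofNat i =>
      refine ⟨DirectSum.lof K ℕ (GrPiece V) i ∘ₗ DirectSum.component K ℕ (GrPiece V) i, ?_, ?_⟩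
      · rintro _ ⟨y, rfl⟩
        simp [DirectSum.component.lof_self]
      · intro m hm x hx
        cases m with
        | ofNat j =>
          obtain ⟨y, rfl⟩ := hx
          have hij : j ≠ i := fun h => hm (by rw [h])
          rw [LinearMap.comp_apply, DirectSum.component.of, dif_neg hij, map_zero]
        | negSucc j =>
          have : x = 0 := hx
          simp [this]
    | negSucc i =>
      refine ⟨0, fun x hx => ?_, fun m hm x hx => rfl⟩
      have : x = 0 := hx
      simp [this]
  refine DirectSum.isInternal_submodule_of_iSupIndep_of_iSup_eq_top (R := K) (M := GrMod V)
    (A := grDeg V) ?_ ?_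
  · intro n
    rw [Submodule.disjoint_def]
    intro x hx hx'
    obtain ⟨π, h1, h2⟩ := key n
    have : (⨆ (m) (_ : m ≠ n), grDeg V m) ≤ LinearMap.ker π :=
      iSup₂_le fun m hm y hy => h2 m hm y hy
    rw [← h1 x hx]
    exact this hx'
  · rw [eq_top_iff]
    intro x _
    induction x using GrMod.induction with
    | zero => exact zero_mem _
    | mk i a ha => exact Submodule.mem_iSup_of_mem (i : ℤ) (mk_mem_grDeg V i ⟨a, ha⟩)
    | add x y hx hy => exact add_mem (hx trivial) (hy trivial)

end Filtered

/-! ## Functors from a `K`-category to vector spaces -/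

section ModC

variable (K : Type w) [Field K] {C : Type u} [Category.{v} C] [Preadditive C] [Linear K C]

/-- Being an additive (`K`-linear) functor from `Cᵒᵖ` to `K`-vector spaces. -/
def isKLinear (C : Type u) [Category.{v} C] [Preadditive C] [Linear K C] :
    ObjectProperty (Cᵒᵖ ⥤ ModuleCat.{v} K) :=
  fun F => F.Additive ∧
    ∀ (X Y : C) (f : X ⟶ Y) (c : K), F.map (c • f).op = c • F.map f.op

/-- The category `Mod(C)` of additive (`K`-linear) functors from `Cᵒᵖ` to `K`-vector spaces. -/
abbrev ModC (C : Type u) [Category.{v} C] [Preadditive C] [Linear K C] :=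
  (isKLinear K C).FullSubcategory

variable {K}

/-- The value `F(X)`. -/
abbrev ModC.ev (F : ModC K C) (X : C) : ModuleCat.{v} K :=
  F.obj.obj (op X)

/-- The action `(X ⟶ Y) × F(Y) → F(X)`, `(f, y) ↦ F(f)(y)`. -/
def ModC.act (F : ModC K C) (X Y : C) :
    (X ⟶ Y) →ₗ[K] F.ev Y →ₗ[K] F.ev X where
  toFun f := (F.obj.map f.op).hom
  map_add' f g := by
    obtain ⟨h, _⟩ := F.property
    rw [op_add, F.obj.map_add, ModuleCat.hom_add]
  map_smul' c f := by
    rw [F.property.2, ModuleCat.hom_smul, RingHom.id_apply]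

/-- The component `F(X) → G(X)` of a morphism of functors. -/
abbrev ModC.app {F G : ModC K C} (η : F ⟶ G) (X : C) :
    F.ev X →ₗ[K] G.ev X :=
  (η.hom.app (op X)).hom

variable (K) in
/-- The representable functor `Hom_C(-, X)`. -/
def repr (X : C) : ModC K C :=
  ⟨(linearYoneda K C).obj X, inferInstance, fun _ _ f c =>
    ModuleCat.hom_ext (LinearMap.ext fun g => Linear.smul_comp _ _ _ c f g)⟩

/-- A family of subspaces of the values of `F`. -/
abbrev ModC.Sub (F : ModC K C) :=
  ∀ X : C, Submodule K (F.ev X)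

/-- The family `S` is a subfunctor. -/
def ModC.IsSubfunctor {F : ModC K C} (S : F.Sub) : Prop :=
  ∀ (X Y : C) (f : X ⟶ Y), ∀ y ∈ S Y, F.act X Y f y ∈ S X

/-- The kernel of a morphism of functors. -/
def ModC.ker {F G : ModC K C} (η : F ⟶ G) : F.Sub :=
  fun X => LinearMap.ker (ModC.app η X)

/-- A simple functor: nonzero, and without subfunctors other than `0` and itself. -/
def ModC.IsSimple (F : ModC K C) : Prop :=
  (∃ (X : C) (x : F.ev X), x ≠ 0) ∧
    ∀ S : F.Sub, ModC.IsSubfunctor S → (∀ X, S X = ⊥) ∨ ∀ X, S X = ⊤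

/-- A finitely generated functor: a quotient of a representable functor (the categories
considered are additive, so finite direct sums of representable functors are representable). -/
def ModC.IsFG (F : ModC K C) : Prop :=
  ∃ (X : C) (η : repr K X ⟶ F), ∀ Y, Function.Surjective (ModC.app η Y)

end ModC

/-! ## The radical of a `K`-category and its powers -/

section Radical

variable (K : Type w) [Field K] {C : Type u} [Category.{v} C] [Preadditive C] [Linear K C]

theorem mem_jacobson_End {X : C} {x : End X} :
    x ∈ Ring.jacobson (End X) ↔ ∀ y : X ⟶ X, ∃ z : X ⟶ X, x ≫ y ≫ z + z = 𝟙 X := by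
  rw [← Ideal.jacobson_bot, Ideal.mem_jacobson_iff]
  refine forall_congr' fun y => exists_congr fun z => ?_
  rw [Submodule.mem_bot, sub_eq_zero]
  rfl

/-- The radical of the category `C`: the maps `f : X ⟶ Y` such that `gf` lies in the Jacobson
radical of the ring `End(X)` for all `g : Y ⟶ X`. -/
def rad (X Y : C) : Submodule K (X ⟶ Y) where
  carrier := {f | ∀ g : Y ⟶ X, (f ≫ g : End X) ∈ Ring.jacobson (End X)}
  zero_mem' := fun g => by
    rw [Limits.zero_comp]
    exact zero_mem _
  add_mem' := fun {a b} ha hb g => by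
    rw [Preadditive.add_comp]
    exact add_mem (ha g) (hb g)
  smul_mem' := fun c f hf g => by
    rw [Linear.smul_comp, ← Linear.comp_smul]
    exact hf _

theorem rad_comp_left {X Y Z : C} (k : X ⟶ Y) {f : Y ⟶ Z} (hf : f ∈ rad K Y Z) :
    k ≫ f ∈ rad K X Z := by
  intro g
  rw [mem_jacobson_End]
  intro y
  obtain ⟨z, hz⟩ := mem_jacobson_End.1 (hf (g ≫ y ≫ k)) (𝟙 Y)
  refine ⟨𝟙 X - k ≫ z ≫ f ≫ g ≫ y, ?_⟩
  have h := congrArg (fun t => k ≫ t ≫ f ≫ g ≫ y) hz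
  simp only [Preadditive.add_comp, Preadditive.comp_add, Category.assoc, Category.id_comp] at h
  simp only [Preadditive.comp_sub, Category.assoc, Category.comp_id]
  rw [← h]
  abel

theorem rad_comp_right {X Y Z : C} {f : X ⟶ Y} (hf : f ∈ rad K X Y) (k : Y ⟶ Z) :
    f ≫ k ∈ rad K X Z := by
  intro g
  rw [Category.assoc]
  exact hf _

/-- The powers of the radical: `rad^0 = Hom`, and `rad^(n+1)(X, Y)` consists of the finite sums
of maps `hg` with `g` in `rad^n(X, Z)` and `h` in `rad(Z, Y)`. -/
def radPow : ℕ → ∀ X Y : C, Submodule K (X ⟶ Y)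
  | 0, _, _ => ⊤
  | n + 1, X, Y => Submodule.span K
      {f | ∃ (Z : C) (g : X ⟶ Z) (h : Z ⟶ Y), g ∈ radPow n X Z ∧ h ∈ rad K Z Y ∧ f = g ≫ h}

theorem radPow_comp_left {X Y : C} (k : X ⟶ Y) :
    ∀ (n : ℕ) {Z : C} {f : Y ⟶ Z}, f ∈ radPow K n Y Z → k ≫ f ∈ radPow K n X Z
  | 0, _, _, _ => trivial
  | n + 1, Z, f, hf => by
    induction hf using Submodule.span_induction with
    | mem f hf =>
      obtain ⟨W, g, h, hg, hh, rfl⟩ := hf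
      exact Submodule.subset_span
        ⟨W, k ≫ g, h, radPow_comp_left k n hg, hh, (Category.assoc _ _ _).symm⟩
    | zero => rw [Limits.comp_zero]; exact zero_mem _
    | add f g _ _ hf hg => rw [Preadditive.comp_add]; exact add_mem hf hg
    | smul c f _ hf => rw [Linear.comp_smul]; exact Submodule.smul_mem _ _ hf

theorem radPow_comp_right {X Y Z : C} (n : ℕ) {f : X ⟶ Y} (hf : f ∈ radPow K n X Y) (k : Y ⟶ Z) :
    f ≫ k ∈ radPow K n X Z := by
  cases n with
  | zero => trivial
  | succ n =>
    induction hf using Submodule.span_induction with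
    | mem f hf =>
      obtain ⟨W, g, h, hg, hh, rfl⟩ := hf
      exact Submodule.subset_span ⟨W, g, h ≫ k, hg, rad_comp_right K hh k, Category.assoc _ _ _⟩
    | zero => rw [Limits.zero_comp]; exact zero_mem _
    | add f g _ _ hf hg => rw [Preadditive.add_comp]; exact add_mem hf hg
    | smul c f _ hf => rw [Linear.smul_comp]; exact Submodule.smul_mem _ _ hf

theorem radPow_comp (i : ℕ) {X Y : C} {f : X ⟶ Y} (hf : f ∈ radPow K i X Y) :
    ∀ (j : ℕ) {Z : C} {g : Y ⟶ Z}, g ∈ radPow K j Y Z → f ≫ g ∈ radPow K (i + j) X Z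
  | 0, _, g, _ => radPow_comp_right K i hf g
  | j + 1, Z, g, hg => by
    induction hg using Submodule.span_induction with
    | mem g hg =>
      obtain ⟨W, g, h, hg, hh, rfl⟩ := hg
      exact Submodule.subset_span
        ⟨W, f ≫ g, h, radPow_comp i hf j hg, hh, (Category.assoc _ _ _).symm⟩
    | zero => rw [Limits.comp_zero]; exact zero_mem _
    | add f g _ _ hf hg => rw [Preadditive.comp_add]; exact add_mem hf hg
    | smul c f _ hf => rw [Linear.comp_smul]; exact Submodule.smul_mem _ _ hf

variable {K} in
/-- `rad^i S` for a subfunctor `S` of a functor `F`: the value at `X` is the sum of the subspaces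
`F(f)(S(Y))` over all `Y` and all `f` in `rad^i(X, Y)`. -/
def radMul {F : ModC K C} (i : ℕ) (S : F.Sub) : F.Sub :=
  fun X => ⨆ (Y : C) (f : radPow K i X Y), (S Y).map (F.act X Y f.1)

variable {K} in
/-- The filtration of `F(X)` by the subspaces `(rad^i F)(X)`. -/
def radFilt (F : ModC K C) (X : C) (i : ℕ) : Submodule K (F.ev X) :=
  radMul i (fun _ => ⊤ : F.Sub) X

variable {K} in
theorem act_mem_radFilt (F : ModC K C) {X Y : C} (i j : ℕ) (f : X ⟶ Y) (hf : f ∈ radPow K i X Y)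
    (y : F.ev Y) (hy : y ∈ radFilt F Y j) : F.act X Y f y ∈ radFilt F X (i + j) := by
  have : radFilt F Y j ≤ (radFilt F X (i + j)).comap (F.act X Y f) := by
    refine iSup_le fun Z => iSup_le fun g => ?_
    rintro _ ⟨z, -, rfl⟩
    refine Submodule.mem_iSup_of_mem Z
      (Submodule.mem_iSup_of_mem ⟨f ≫ g.1, radPow_comp K i hf j g.2⟩ ⟨z, trivial, ?_⟩)
    change (F.obj.map (f ≫ g.1).op).hom z = (F.obj.map f.op).hom ((F.obj.map g.1.op).hom z)
    rw [op_comp, F.obj.map_comp, ModuleCat.hom_comp, LinearMap.comp_apply]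
  exact this hy

end Radical

/-! ## Graded categories and graded functors -/

section Graded

/-- A graded `K`-category: each `Hom(X, Y)` is the direct sum of its homogeneous parts
`Hom(X, Y)_i`, `i ∈ ℤ`, and degrees add under composition. -/
class GradedCategory (K : Type w) [Field K] (D : Type u) [Category.{v} D] [Preadditive D]
    [Linear K D] where
  deg : ∀ X Y : D, ℤ → Submodule K (X ⟶ Y)
  isInternal : ∀ X Y : D, DirectSum.IsInternal (deg X Y)
  id_mem : ∀ X : D, 𝟙 X ∈ deg X X 0
  comp_mem : ∀ {X Y Z : D} {i j : ℤ} {f : X ⟶ Y} {g : Y ⟶ Z}, f ∈ deg X Y i → g ∈ deg Y Z j →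
    f ≫ g ∈ deg X Z (i + j)

variable (K : Type w) [Field K] (D : Type u) [Category.{v} D] [Preadditive D] [Linear K D]
  [GradedCategory K D]

/-- The graded category is positively graded: `Hom(X, Y)_i = 0` for `i < 0`. -/
def IsPositivelyGraded : Prop :=
  ∀ (X Y : D) (i : ℤ), i < 0 → GradedCategory.deg (K := K) X Y i = ⊥

/-- The graded category is locally finite: each `Hom(X, Y)_i` is finite dimensional. -/
def IsLocallyFinite : Prop :=
  ∀ (X Y : D) (i : ℤ), Module.Finite K (GradedCategory.deg (K := K) X Y i)

variable {D}

/-- The ring `End(X)_0`. -/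
def degZeroEnd (X : D) : Subring (End X) where
  carrier := {f | (show X ⟶ X from f) ∈ GradedCategory.deg (K := K) X X 0}
  mul_mem' := fun {a b} ha hb => by
    have := GradedCategory.comp_mem (K := K) (D := D) hb ha
    rwa [add_zero] at this
  one_mem' := GradedCategory.id_mem X
  add_mem' := fun {a b} ha hb =>
    (GradedCategory.deg (K := K) X X 0).add_mem ha hb
  zero_mem' := zero_mem (GradedCategory.deg (K := K) X X 0)
  neg_mem' := fun {a} ha =>
    (GradedCategory.deg (K := K) X X 0).neg_mem ha

/-- The maps `ι` and `π` present `X` as the direct sum of the finite family `Y`. -/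
def IsDirectSum {E : Type u} [Category.{v} E] [Preadditive E] {n : ℕ} (Y : Fin n → E) (X : E)
    (ι : ∀ i, Y i ⟶ X) (π : ∀ i, X ⟶ Y i) : Prop :=
  (∀ i, ι i ≫ π i = 𝟙 (Y i)) ∧ (∀ i j, i ≠ j → ι i ≫ π j = 0) ∧ ∑ i, π i ≫ ι i = 𝟙 X

/-- The same, in a graded category, where `ι` and `π` are required to have degree zero. -/
def IsGradedDirectSum {n : ℕ} (Y : Fin n → D) (X : D)
    (ι : ∀ i, Y i ⟶ X) (π : ∀ i, X ⟶ Y i) : Prop :=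
  IsDirectSum Y X ι π ∧ (∀ i, ι i ∈ GradedCategory.deg (K := K) (Y i) X 0) ∧
    ∀ i, π i ∈ GradedCategory.deg (K := K) X (Y i) 0

variable (D) in
/-- A Krull-Schmidt graded `K`-category: finite direct sums exist, and any object is a finite
direct sum of objects with graded local endomorphism ring (that is, with `End(Y)_0` local). -/
def IsGradedKrullSchmidt : Prop :=
  (∀ (n : ℕ) (Y : Fin n → D), ∃ X ι π, IsGradedDirectSum K Y X ι π) ∧
    ∀ X : D, ∃ (n : ℕ) (Y : Fin n → D), (∃ ι π, IsGradedDirectSum K Y X ι π) ∧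
      ∀ i, IsLocalRing (degZeroEnd K (Y i))

/-- A graded functor from `Dᵒᵖ` to graded `K`-vector spaces: a morphism of degree `i` acts as a
linear map of degree `i`. -/
structure GradedFunctor (K : Type w) [Field K] (D : Type u) [Category.{v} D] [Preadditive D]
    [Linear K D] [GradedCategory K D] where
  toMod : ModC K D
  deg : ∀ X : D, ℤ → Submodule K (toMod.ev X)
  isInternal : ∀ X : D, DirectSum.IsInternal (deg X)
  act_mem : ∀ {X Y : D} {i j : ℤ} {f : X ⟶ Y} {y : toMod.ev Y},
    f ∈ GradedCategory.deg (K := K) X Y i → y ∈ deg Y j → toMod.act X Y f y ∈ deg X (i + j)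

variable {K}

/-- The shift `M[k]`, with `M[k]_j = M_{k+j}`. -/
def GradedFunctor.shift (M : GradedFunctor K D) (k : ℤ) : GradedFunctor K D where
  toMod := M.toMod
  deg X j := M.deg X (k + j)
  isInternal X := by
    have h := DirectSum.isInternal_submodule_iff_iSupIndep_and_iSup_eq_top _ |>.1 (M.isInternal X)
    refine DirectSum.isInternal_submodule_of_iSupIndep_of_iSup_eq_top
      (h.1.comp (add_right_injective k)) ?_
    rw [← h.2]
    exact (Equiv.addLeft k).iSup_comp (g := M.deg X)
  act_mem {X Y i j f y} hf hy := by
    have := M.act_mem hf hy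
    rwa [add_left_comm] at this

variable (K) in
/-- The graded representable functor `Hom_D(-, X)`. -/
def gradedRepr (X : D) : GradedFunctor K D where
  toMod := repr K X
  deg Y := GradedCategory.deg Y X
  isInternal Y := GradedCategory.isInternal Y X
  act_mem hf hy := GradedCategory.comp_mem hf hy

/-- The morphism of functors `η` has degree zero, that is, it is a morphism in `Gr(D)_0`. -/
def IsDegreeZero {M N : GradedFunctor K D} (η : M.toMod ⟶ N.toMod) : Prop :=
  ∀ (X : D) (j : ℤ), ∀ x ∈ M.deg X j, ModC.app η X x ∈ N.deg X j

/-- A linear functor: it has a projective graded resolution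
`⋯ → Hom(-, X 2)[-2] → Hom(-, X 1)[-1] → Hom(-, X 0) → M → 0` with morphisms of degree zero. -/
def IsLinear (M : GradedFunctor K D) : Prop :=
  ∃ (X : ℕ → D)
    (d : ∀ n : ℕ, ((gradedRepr K (X (n + 1))).shift (-((n + 1 : ℕ) : ℤ))).toMod ⟶
      ((gradedRepr K (X n)).shift (-(n : ℤ))).toMod)
    (ε : (gradedRepr K (X 0)).toMod ⟶ M.toMod),
    (∀ n, IsDegreeZero (M := (gradedRepr K (X (n + 1))).shift (-((n + 1 : ℕ) : ℤ)))
      (N := (gradedRepr K (X n)).shift (-(n : ℤ))) (d n)) ∧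
    IsDegreeZero (M := gradedRepr K (X 0)) (N := M) ε ∧
    ∀ Y : D, Function.Surjective (ModC.app ε Y) ∧
      Function.Exact (ModC.app (d 0) Y) (ModC.app ε Y) ∧
      ∀ n, Function.Exact (ModC.app (d (n + 1)) Y) (ModC.app (d n) Y)

/-- A simple graded functor: nonzero, and without graded subfunctors other than `0` and itself. -/
def GradedFunctor.IsSimple (M : GradedFunctor K D) : Prop :=
  (∃ (X : D) (x : M.toMod.ev X), x ≠ 0) ∧
    ∀ S : M.toMod.Sub, ModC.IsSubfunctor S → (∀ X, S X = ⨆ j : ℤ, S X ⊓ M.deg X j) →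
      (∀ X, S X = ⊥) ∨ ∀ X, S X = ⊤

variable (K D) in
/-- A Koszul category: a positively graded Krull-Schmidt locally finite `K`-category all of whose
simple graded functors are, up to shift, linear. (A simple functor lives in a single degree, and a
linear functor is generated in degree zero, so the shift is the one that moves the simple functor
to degree zero.) -/
def IsKoszulCategory : Prop :=
  IsPositivelyGraded K D ∧ IsGradedKrullSchmidt K D ∧ IsLocallyFinite K D ∧
    ∀ S : GradedFunctor K D, S.IsSimple → ∃ k : ℤ, IsLinear (S.shift k)

end Graded

/-! ## The associated graded category and the associated graded functor -/

section AssocGraded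

/-- The objects of the associated graded category `A_gr(C)`: they are the objects of `C`. -/
structure AGr (K : Type w) (C : Type u) where
  obj : C

variable (K : Type w) [Field K] (C : Type u) [Category.{v} C] [Preadditive C] [Linear K C]

/-- The filtration of `Hom(X, Y)` by the powers of the radical. -/
abbrev homFilt {C : Type u} [Category.{v} C] [Preadditive C] [Linear K C] (X Y : C) :
    ℕ → Submodule K (X ⟶ Y) :=
  fun i => radPow K i X Y

/-- Composition in `A_gr(C)`, induced by the composition in `C`. -/
def agrComp {C : Type u} [Category.{v} C] [Preadditive C] [Linear K C] (X Y Z : C) :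
    GrMod (homFilt K X Y) →ₗ[K] GrMod (homFilt K Y Z) →ₗ[K] GrMod (homFilt K X Z) :=
  grBilin _ _ _ (Linear.comp X Y Z) (fun i j _ hf _ hg => radPow_comp K i hf j hg)

theorem agrComp_mk {C : Type u} [Category.{v} C] [Preadditive C] [Linear K C] {X Y Z : C}
    {i j : ℕ} {f : X ⟶ Y} {g : Y ⟶ Z} (hf : f ∈ homFilt K X Y i) (hg : g ∈ homFilt K Y Z j) :
    agrComp K X Y Z (GrMod.mk (homFilt K X Y) i ⟨f, hf⟩) (GrMod.mk (homFilt K Y Z) j ⟨g, hg⟩) =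
      GrMod.mk (homFilt K X Z) (i + j) ⟨f ≫ g, radPow_comp K i hf j hg⟩ :=
  grBilin_mk _ _ _ _ _ hf hg

/-- `Hom(X, Y) = ⨁_{i ≥ 0} rad^i(X, Y) / rad^(i+1)(X, Y)` in `A_gr(C)`. -/
instance : Category.{v} (AGr K C) where
  Hom X Y := GrMod (homFilt K X.obj Y.obj)
  id X := GrMod.mk (homFilt K X.obj X.obj) 0 ⟨𝟙 X.obj, trivial⟩
  comp {X Y Z} f g := agrComp K X.obj Y.obj Z.obj f g
  id_comp {X Y} f := by
    induction f using GrMod.induction with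
    | zero => exact map_zero _
    | mk i a ha =>
      exact (grBilin_mk _ _ _ _ _ _ _).trans
        (GrMod.mk_congr _ (zero_add i) _ _ (Category.id_comp a))
    | add f g hf hg => rw [map_add, hf, hg]
  comp_id {X Y} f := by
    induction f using GrMod.induction with
    | zero => exact LinearMap.map_zero₂ _ _
    | mk i a ha =>
      exact (grBilin_mk _ _ _ _ _ _ _).trans
        (GrMod.mk_congr _ (add_zero i) _ _ (Category.comp_id a))
    | add f g hf hg => rw [LinearMap.map_add₂, hf, hg]
  assoc {W X Y Z} f g h := by
    induction f using GrMod.induction with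
    | zero => simp only [map_zero, LinearMap.zero_apply]
    | add f f' hf hf' => simp only [LinearMap.map_add₂, hf, hf']
    | mk i a ha =>
      induction g using GrMod.induction with
      | zero => simp only [map_zero, LinearMap.zero_apply]
      | add g g' hg hg' => simp only [LinearMap.add_apply, map_add, hg, hg']
      | mk j b hb =>
        induction h using GrMod.induction with
        | zero => simp only [map_zero]
        | add h h' hh hh' => simp only [map_add, hh, hh']
        | mk k c hc =>
          rw [agrComp_mk, agrComp_mk, agrComp_mk, agrComp_mk]
          exact GrMod.mk_congr _ (add_assoc i j k) _ _ (Category.assoc a b c)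

instance : Preadditive (AGr K C) where
  homGroup X Y := inferInstanceAs (AddCommGroup (GrMod (homFilt K X.obj Y.obj)))
  add_comp X Y Z f f' g := LinearMap.map_add₂ (agrComp K X.obj Y.obj Z.obj) f f' g
  comp_add X Y Z f g g' := (agrComp K X.obj Y.obj Z.obj f).map_add g g'

instance : Linear K (AGr K C) where
  homModule X Y := inferInstanceAs (Module K (GrMod (homFilt K X.obj Y.obj)))
  smul_comp X Y Z r f g := LinearMap.map_smul₂ (agrComp K X.obj Y.obj Z.obj) r f g
  comp_smul X Y Z f r g := (agrComp K X.obj Y.obj Z.obj f).map_smul r g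

/-- `Hom(X, Y)_i = rad^i(X, Y) / rad^(i+1)(X, Y)` for `i ≥ 0`, and `Hom(X, Y)_i = 0` for `i < 0`. -/
instance : GradedCategory K (AGr K C) where
  deg X Y := grDeg (homFilt K X.obj Y.obj)
  isInternal X Y := grDeg_isInternal _
  id_mem X := mk_mem_grDeg _ 0 _
  comp_mem {X Y Z i j f g} hf hg := by
    obtain rfl | ⟨m, a, ha, rfl, rfl⟩ := exists_of_mem_grDeg hf
    · rw [Limits.zero_comp]; exact zero_mem _
    obtain rfl | ⟨n, b, hb, rfl, rfl⟩ := exists_of_mem_grDeg hg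
    · rw [Limits.comp_zero]; exact zero_mem _
    rw [← Nat.cast_add]
    have h := mk_mem_grDeg (homFilt K X.obj Z.obj) (m + n) ⟨a ≫ b, radPow_comp K m ha n hb⟩
    rwa [← agrComp_mk K ha hb] at h

variable {K C}

/-- The action of `A_gr(C)` on `⨁ rad^i F / rad^(i+1) F`, induced by the action of `C` on `F`. -/
def agrAct (F : ModC K C) (X Y : C) :
    GrMod (homFilt K X Y) →ₗ[K] GrMod (radFilt F Y) →ₗ[K] GrMod (radFilt F X) :=
  grBilin _ _ _ (F.act X Y) (fun i j f hf y hy => act_mem_radFilt F i j f hf y hy)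

theorem agrAct_mk (F : ModC K C) {X Y : C} {i j : ℕ} {f : X ⟶ Y} {y : F.ev Y}
    (hf : f ∈ homFilt K X Y i) (hy : y ∈ radFilt F Y j) :
    agrAct F X Y (GrMod.mk (homFilt K X Y) i ⟨f, hf⟩) (GrMod.mk (radFilt F Y) j ⟨y, hy⟩) =
      GrMod.mk (radFilt F X) (i + j) ⟨F.act X Y f y, act_mem_radFilt F i j f hf y hy⟩ :=
  grBilin_mk _ _ _ _ _ hf hy

theorem agrAct_mem_grDeg (F : ModC K C) {X Y : C} {i j : ℤ} {f : GrMod (homFilt K X Y)}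
    {y : GrMod (radFilt F Y)} (hf : f ∈ grDeg (homFilt K X Y) i) (hy : y ∈ grDeg (radFilt F Y) j) :
    agrAct F X Y f y ∈ grDeg (radFilt F X) (i + j) := by
  obtain rfl | ⟨m, a, ha, rfl, rfl⟩ := exists_of_mem_grDeg hf
  · rw [map_zero, LinearMap.zero_apply]; exact zero_mem _
  obtain rfl | ⟨n, b, hb, rfl, rfl⟩ := exists_of_mem_grDeg hy
  · rw [map_zero]; exact zero_mem _
  rw [agrAct_mk F ha hb, ← Nat.cast_add]
  exact mk_mem_grDeg _ _ _

theorem agrAct_id (F : ModC K C) (X : AGr K C) (x : GrMod (radFilt F X.obj)) :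
    agrAct F X.obj X.obj (𝟙 X : X ⟶ X) x = x := by
  induction x using GrMod.induction with
  | zero => exact map_zero _
  | mk i a ha =>
    refine (grBilin_mk _ _ _ _ _ _ _).trans (GrMod.mk_congr _ (zero_add i) _ _ ?_)
    change (F.obj.map (𝟙 X.obj).op).hom a = a
    rw [op_id, F.obj.map_id]
    rfl
  | add f g hf hg => rw [map_add, hf, hg]

theorem agrAct_comp (F : ModC K C) {X Y Z : AGr K C} (f : X ⟶ Y) (g : Y ⟶ Z)
    (x : GrMod (radFilt F Z.obj)) :
    agrAct F X.obj Z.obj (f ≫ g) x = agrAct F X.obj Y.obj f (agrAct F Y.obj Z.obj g x) := by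
  change agrAct F X.obj Z.obj (agrComp K X.obj Y.obj Z.obj f g) x = _
  induction f using GrMod.induction with
  | zero => simp only [map_zero, LinearMap.zero_apply]
  | add f f' hf hf' => simp only [map_add, LinearMap.add_apply, hf, hf']
  | mk i a ha =>
    induction g using GrMod.induction with
    | zero => simp only [map_zero, LinearMap.zero_apply]
    | add g g' hg hg' => simp only [map_add, LinearMap.add_apply, hg, hg']
    | mk j b hb =>
      induction x using GrMod.induction with
      | zero => simp only [map_zero]
      | add h h' hh hh' => simp only [map_add, hh, hh']
      | mk k c hc =>
        rw [agrComp_mk, agrAct_mk, agrAct_mk, agrAct_mk]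
        refine GrMod.mk_congr _ (add_assoc i j k) _ _ ?_
        change (F.obj.map (a ≫ b).op).hom c = (F.obj.map a.op).hom ((F.obj.map b.op).hom c)
        rw [op_comp, F.obj.map_comp, ModuleCat.hom_comp, LinearMap.comp_apply]

/-- The functor underlying `G(F)`. -/
def agrMod (F : ModC K C) : ModC K (AGr K C) where
  obj :=
    { obj := fun X => ModuleCat.of K (GrMod (radFilt F X.unop.obj))
      map := fun {X Y} f => ModuleCat.ofHom (agrAct F Y.unop.obj X.unop.obj f.unop)
      map_id := fun X => by
        refine ModuleCat.hom_ext (LinearMap.ext fun x => ?_)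
        exact agrAct_id F X.unop x
      map_comp := fun f g => by
        refine ModuleCat.hom_ext (LinearMap.ext fun x => ?_)
        exact agrAct_comp F g.unop f.unop x }
  property :=
    ⟨⟨fun {X Y f g} => ModuleCat.hom_ext ((agrAct F Y.unop.obj X.unop.obj).map_add f.unop g.unop)⟩,
      fun X Y f c => ModuleCat.hom_ext ((agrAct F X.obj Y.obj).map_smul c f)⟩

/-- The associated graded functor `G(F) = ⨁_{i ≥ 0} rad^i F / rad^(i+1) F`, a graded functor on
`A_gr(C)`. -/
def assocGraded (F : ModC K C) : GradedFunctor K (AGr K C) where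
  toMod := agrMod F
  deg X := grDeg (radFilt F X.obj)
  isInternal _ := grDeg_isInternal _
  act_mem hf hy := agrAct_mem_grDeg F hf hy

end AssocGraded

/-! ## Weakly Koszul functors and categories -/

section WeaklyKoszul

variable (K : Type w) [Field K] (C : Type u) [Category.{v} C] [Preadditive C] [Linear K C]

/-- A Krull-Schmidt category: any object is a finite direct sum of objects with local endomorphism
ring. -/
def IsKrullSchmidt (C : Type u) [Category.{v} C] [Preadditive C] : Prop :=
  ∀ X : C, ∃ (n : ℕ) (Y : Fin n → C), (∃ ι π, IsDirectSum Y X ι π) ∧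
    ∀ i, IsLocalRing (End (Y i))

/-- A locally radical finite category: each `rad^i(X, Y) / rad^(i+1)(X, Y)` is finite
dimensional. -/
def IsLocallyRadicalFinite : Prop :=
  ∀ (X Y : C) (i : ℕ), Module.Finite K (GrPiece (homFilt K X Y) i)

variable {K C}

/-- A weakly Koszul functor: it has a resolution `⋯ → P 1 → P 0 → F → 0` by finitely generated
projective functors in `Mod(C)` such that
`rad^(i+1)(P_j) ∩ Ω^(j+1)(F) = rad^i(Ω^(j+1)(F))` for all `j ≥ 0` and `i ≥ 1`, where
`Ω^(j+1)(F)` is the kernel of the map starting at `P_j` in the resolution. -/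
def IsWeaklyKoszul (F : ModC K C) : Prop :=
  ∃ (P : ℕ → ModC K C) (d : ∀ n, P (n + 1) ⟶ P n) (ε : P 0 ⟶ F),
    (∀ n, (P n).IsFG) ∧ (∀ n, Projective (P n)) ∧
    (∀ X : C, Function.Surjective (ModC.app ε X) ∧
      Function.Exact (ModC.app (d 0) X) (ModC.app ε X) ∧
      ∀ n, Function.Exact (ModC.app (d (n + 1)) X) (ModC.app (d n) X)) ∧
    (∀ (X : C) (i : ℕ), 1 ≤ i →
      radFilt (P 0) X (i + 1) ⊓ ModC.ker ε X = radMul i (ModC.ker ε) X) ∧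
    ∀ (j : ℕ) (X : C) (i : ℕ), 1 ≤ i →
      radFilt (P (j + 1)) X (i + 1) ⊓ ModC.ker (d j) X = radMul i (ModC.ker (d j)) X

variable (K C) in
/-- A weakly Koszul category: an additive Krull-Schmidt locally radical finite `K`-category all of
whose simple functors are weakly Koszul. -/
def IsWeaklyKoszulCategory : Prop :=
  Limits.HasFiniteBiproducts C ∧ IsKrullSchmidt C ∧ IsLocallyRadicalFinite K C ∧
    ∀ S : ModC K C, S.IsSimple → IsWeaklyKoszul S

end WeaklyKoszul

end KoszulCat

end

/-!
A resolution by finitely generated projectives is, by the Yoneda lemma and splitting of idempotents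
(`exists_representing_element`), a sequence of maps `X_{n+1} ⟶ X_n` in `C` together with an element
of `F(X_0)`. The weak Koszul condition then reads: for `i ≥ 1`, the maps in `rad^(i+1)(-, X_n)`
annihilated by the differential starting at `X_n` are the multiples of the incoming differential by
maps in `rad^i` (`IsKoszulCover`, `HasKoszulResolution`).

The resolution need not be minimal. If a differential `c : Z ⟶ X` is not radical, then some
component into an indecomposable summand of `X` is a split epimorphism, and this summand can be
removed from both `Z` and `X` without destroying the weak Koszul condition
(`HasKoszulResolution.remove_summand`). Induction on the number of summands makes one differential
radical, and repeating this for all syzygies gives a resolution all of whose differentials are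
radical (`HasKoszulResolution.exists_minimal`, `HasMinimalKoszulResolution.exists_sequence`).

For such a resolution, the classes of the differentials in `rad / rad^2` have degree one in
`A_gr(C)`, and they form a linear resolution of `G(F)`: if `f` is in `rad^i` and its composite with
the differential is in `rad^(i+2)`, then the weak Koszul condition changes `f` by an element of
`rad^(i+1)` into a map annihilated by the differential, and a second application of the condition
factors the latter through the next differential by a map in `rad^(i-1)`
(`GrMod.exact_of_filtered`, `isLinear_assocGraded`).

A simple graded functor `S` over `A_gr(C)` is concentrated in a single degree `k`
(`GradedFunctor.IsSimple.exists_deg_eq_top`) and is generated by a nonzero element `s` at an object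
`X` with local endomorphism ring. The map `g : Y ⟶ X` annihilates `s` exactly when it is radical, so
`S[k]` is `G` of the simple functor `Hom(-, X) / rad(-, X)`, and Koszulity of `A_gr(C)` follows from
the linearity of `G` of weakly Koszul functors.
-/

namespace KoszulCat

/-! ### The radical and split epimorphisms onto objects with local endomorphism ring -/

section Radical

variable (K : Type w) [Field K] {C : Type u} [Category.{v} C] [Preadditive C] [Linear K C]

theorem radPow_one (X Y : C) : radPow K 1 X Y = rad K X Y := by
  apply le_antisymm
  · refine Submodule.span_le.2 ?_
    rintro _ ⟨Z, g, h, -, hh, rfl⟩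
    exact rad_comp_left K g hh
  · intro f hf
    exact Submodule.subset_span ⟨X, 𝟙 X, f, trivial, hf, (Category.id_comp f).symm⟩

theorem radPow_succ_le (n : ℕ) (X Y : C) : radPow K (n + 1) X Y ≤ radPow K n X Y := by
  refine Submodule.span_le.2 ?_
  rintro _ ⟨Z, g, h, hg, -, rfl⟩
  exact radPow_comp_right K n hg h

theorem radPow_le_rad {n : ℕ} (hn : 1 ≤ n) (X Y : C) : radPow K n X Y ≤ rad K X Y := by
  induction n, hn using Nat.le_induction with
  | base => exact (radPow_one K X Y).le
  | succ n _ ih => exact (radPow_succ_le K n X Y).trans ih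

theorem id_notMem_rad (X : C) [Nontrivial (End X)] : 𝟙 X ∉ rad K X X := by
  intro h
  have h1 := h (𝟙 X)
  rw [mem_jacobson_End] at h1
  obtain ⟨z, hz⟩ := h1 (-𝟙 X)
  simp only [Category.id_comp, Preadditive.neg_comp, neg_add_cancel] at hz
  exact zero_ne_one (α := End X) hz

/-- A map into an object with local endomorphism ring is either radical or a split epimorphism. -/
theorem exists_section_of_notMem_rad {Z Y : C} [IsLocalRing (End Y)] {f : Z ⟶ Y}
    (hf : f ∉ rad K Z Y) : ∃ a : Y ⟶ Z, a ≫ f = 𝟙 Y := by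
  by_contra! hno
  refine hf fun g => ?_
  have hunit : ∀ a : Y ⟶ Z, ∃ w : Y ⟶ Y, (𝟙 Y + a ≫ f) ≫ w = 𝟙 Y := by
    intro a
    have hadd : (show End Y from 𝟙 Y + a ≫ f) + (show End Y from -(a ≫ f)) = 1 :=
      add_neg_cancel_right (𝟙 Y) (a ≫ f)
    rcases IsLocalRing.isUnit_or_isUnit_of_add_one hadd with h | h
    · obtain ⟨w, hw⟩ := h.exists_left_inv
      exact ⟨w, hw⟩
    · obtain ⟨w, hw⟩ := h.exists_right_inv
      have hw' : w ≫ (-(a ≫ f)) = 𝟙 Y := hw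
      exact absurd (by simpa using hw') (hno (-w ≫ a))
  rw [mem_jacobson_End]
  intro y
  obtain ⟨w, hw⟩ := hunit (g ≫ y)
  refine ⟨𝟙 Z - f ≫ w ≫ g ≫ y, ?_⟩
  have h := congrArg (fun t => f ≫ t ≫ g ≫ y) hw
  simp only [Preadditive.add_comp, Preadditive.comp_add, Category.assoc, Category.id_comp] at h
  simp only [Preadditive.comp_sub, Category.assoc, Category.comp_id]
  rw [← h]
  abel

end Radical

/-! ### Koszul covers of families of maps -/

section Cover

variable {K : Type w} [Field K] {C : Type u} [Category.{v} C] [Preadditive C] [Linear K C]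

variable (K) in
/-- A family of subspaces of the spaces `Hom(Y, X)`, `X` being fixed. -/
abbrev HomSub (X : C) := ∀ Y : C, Submodule K (Y ⟶ X)

/-- The maps which are annihilated by composition with `c`. -/
def HomSub.ker {Z X : C} (c : Z ⟶ X) : HomSub K Z :=
  fun Y => LinearMap.ker (Linear.rightComp K Y c)

/-- The maps into `X'` which the map `j` sends into `S`. -/
def HomSub.comap {X' X : C} (j : X' ⟶ X) (S : HomSub K X) : HomSub K X' :=
  fun Y => (S Y).comap (Linear.rightComp K Y j)

theorem HomSub.mem_ker {Z X : C} {c : Z ⟶ X} {Y : C} {f : Y ⟶ Z} :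
    f ∈ HomSub.ker (K := K) c Y ↔ f ≫ c = 0 := Iff.rfl

theorem HomSub.mem_comap {X' X : C} {j : X' ⟶ X} {S : HomSub K X} {Y : C} {f : Y ⟶ X'} :
    f ∈ HomSub.comap j S Y ↔ f ≫ j ∈ S Y := Iff.rfl

/-- The map `c : Z ⟶ X` makes `Hom(-, Z)` a cover of the subfunctor `S` of `Hom(-, X)`, and
`rad^(i+1)(-, X) ∩ S = rad^i S` for `i ≥ 1`. -/
structure IsKoszulCover {X : C} (S : HomSub K X) {Z : C} (c : Z ⟶ X) : Prop where
  mem_iff : ∀ {Y : C} {f : Y ⟶ X}, f ∈ S Y ↔ ∃ g : Y ⟶ Z, g ≫ c = f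
  rad_iff : ∀ {i : ℕ}, 1 ≤ i → ∀ {Y : C} {f : Y ⟶ X},
    (f ∈ radPow K (i + 1) Y X ∧ f ∈ S Y) ↔ ∃ g ∈ radPow K i Y Z, g ≫ c = f

/-- The subfunctor `S` of `Hom(-, X)` has a resolution by representable functors whose maps are
Koszul covers. The resolution is encoded as a predicate closed under passing to syzygies, that is,
`HasKoszulResolution` is the greatest predicate with that property. -/
def HasKoszulResolution {X : C} (S : HomSub K X) : Prop :=
  ∃ R : ∀ X : C, HomSub K X → Prop,
    (∀ X S, R X S → ∃ (Z : C) (c : Z ⟶ X), IsKoszulCover S c ∧ R Z (HomSub.ker c)) ∧ R X S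

/-- A Koszul resolution whose first map is radical. -/
def HasMinimalKoszulResolution {X : C} (S : HomSub K X) : Prop :=
  ∃ (Z : C) (c : Z ⟶ X), c ∈ rad K Z X ∧ IsKoszulCover S c ∧
    HasKoszulResolution (HomSub.ker (K := K) c)

theorem HasKoszulResolution.exists_cover {X : C} {S : HomSub K X} (h : HasKoszulResolution S) :
    ∃ (Z : C) (c : Z ⟶ X), IsKoszulCover S c ∧ HasKoszulResolution (HomSub.ker (K := K) c) := by
  obtain ⟨R, hR, h⟩ := h
  obtain ⟨Z, c, hc, hZ⟩ := hR X S h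
  exact ⟨Z, c, hc, R, hR, hZ⟩

theorem HasKoszulResolution.of_cover {X : C} {S : HomSub K X} {Z : C} {c : Z ⟶ X}
    (hc : IsKoszulCover S c) (h : HasKoszulResolution (HomSub.ker (K := K) c)) :
    HasKoszulResolution S := by
  refine ⟨fun X S => ∃ (Z : C) (c : Z ⟶ X), IsKoszulCover S c ∧
    HasKoszulResolution (HomSub.ker (K := K) c), ?_, Z, c, hc, h⟩
  rintro X S ⟨Z, c, hc, h⟩
  exact ⟨Z, c, hc, h.exists_cover⟩

/-- A Koszul cover `c : Z ⟶ X` restricts to one on any direct summand of `Z` whose complement is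
annihilated by `c`. -/
theorem IsKoszulCover.restrict {X : C} {S : HomSub K X} {Z Z' : C} {c : Z ⟶ X}
    (hc : IsKoszulCover S c) {k : Z' ⟶ Z} {r : Z ⟶ Z'} (h : r ≫ k ≫ c = c) :
    IsKoszulCover S (k ≫ c) where
  mem_iff := by
    intro Y f
    rw [hc.mem_iff]
    constructor
    · rintro ⟨g, rfl⟩
      exact ⟨g ≫ r, by rw [Category.assoc, h]⟩
    · rintro ⟨g, rfl⟩
      exact ⟨g ≫ k, Category.assoc _ _ _⟩
  rad_iff := by
    intro i hi Y f
    rw [hc.rad_iff hi]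
    constructor
    · rintro ⟨g, hg, rfl⟩
      exact ⟨g ≫ r, radPow_comp_right K i hg r, by rw [Category.assoc, h]⟩
    · rintro ⟨g, hg, rfl⟩
      exact ⟨g ≫ k, radPow_comp_right K i hg k, Category.assoc _ _ _⟩

/-- If the cover `c : Z ⟶ X` hits a direct summand `Y` of `X` (with inclusion `ι` and projection
`π`), then `Y` may be removed from `X` and from `Z`. -/
theorem HasKoszulResolution.remove_summand {X Y Z X' Z' : C} {S : HomSub K X} {c : Z ⟶ X}
    (hc : IsKoszulCover S c) (hZ : HasKoszulResolution (HomSub.ker (K := K) c))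
    {ι : Y ⟶ X} {π : X ⟶ Y} {a : Y ⟶ Z} (ha : a ≫ c ≫ π = 𝟙 Y)
    {j : X' ⟶ X} {q : X ⟶ X'} (hjq : j ≫ q = 𝟙 X') (hqj : q ≫ j = 𝟙 X - π ≫ ι)
    (hjπ : j ≫ π = 0)
    {k : Z' ⟶ Z} {r : Z ⟶ Z'} (hkr : k ≫ r = 𝟙 Z') (hrk : r ≫ k = 𝟙 Z - c ≫ π ≫ a) :
    HasKoszulResolution (HomSub.comap j S) := by
  have hkcπ : k ≫ c ≫ π = 0 := by
    have h : k ≫ r ≫ k ≫ c ≫ π = k ≫ c ≫ π := by rw [← Category.assoc, hkr, Category.id_comp]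
    rw [← h, reassoc_of% hrk]
    simp only [Preadditive.sub_comp, Category.id_comp, Category.assoc, ha, Category.comp_id,
      sub_self, Limits.comp_zero]
  -- `c' = k ≫ c ≫ q` is the restriction of `c` to the kernels of the projections onto `Y`
  have hc'j : (k ≫ c ≫ q) ≫ j = k ≫ c := by
    simp only [Category.assoc, hqj, Preadditive.comp_sub, Category.comp_id]
    rw [reassoc_of% hkcπ, Limits.zero_comp, sub_zero]
  have hj : ∀ {W : C} {f g : W ⟶ X'}, f ≫ j = g ≫ j → f = g := by
    intro W f g h
    have := congrArg (· ≫ q) h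
    simpa only [Category.assoc, hjq, Category.comp_id] using this
  have hlift : ∀ {W : C} {f : W ⟶ X'} {g : W ⟶ Z}, g ≫ c = f ≫ j →
      (g ≫ r) ≫ k ≫ c ≫ q = f := by
    intro W f g h
    apply hj
    have h0 : g ≫ c ≫ π = 0 := by rw [reassoc_of% h, hjπ, Limits.comp_zero]
    rw [Category.assoc, Category.assoc, hc'j, reassoc_of% hrk, ← h]
    simp only [Preadditive.sub_comp, Category.id_comp, Category.assoc, Preadditive.comp_sub]
    rw [reassoc_of% h0, Limits.zero_comp, sub_zero]
  have hcover : IsKoszulCover (HomSub.comap j S) (k ≫ c ≫ q) := by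
    constructor
    · intro W f
      rw [HomSub.mem_comap, hc.mem_iff]
      constructor
      · rintro ⟨g, hg⟩
        exact ⟨g ≫ r, hlift hg⟩
      · rintro ⟨g, rfl⟩
        exact ⟨g ≫ k, by rw [Category.assoc g _ j, hc'j, Category.assoc]⟩
    · intro i hi W f
      rw [HomSub.mem_comap]
      constructor
      · rintro ⟨hf, hfS⟩
        obtain ⟨g, hg, hgf⟩ := (hc.rad_iff hi).1 ⟨radPow_comp_right K (i + 1) hf j, hfS⟩
        exact ⟨g ≫ r, radPow_comp_right K i hg r, hlift hgf⟩
      · rintro ⟨g, hg, rfl⟩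
        have h := (hc.rad_iff hi).2
          ⟨g ≫ k, radPow_comp_right K i hg k, (Category.assoc _ _ _)⟩
        refine ⟨?_, ?_⟩
        · have := radPow_comp_right K (i + 1) h.1 q
          simpa only [Category.assoc] using this
        · rw [Category.assoc g _ j, hc'j]
          exact h.2
  obtain ⟨Z₂, c₂, hc₂, hZ₂⟩ := hZ.exists_cover
  have hc₂c : c₂ ≫ c = 0 := HomSub.mem_ker.1 (hc₂.mem_iff.2 ⟨𝟙 _, Category.id_comp _⟩)
  have hc₂k : (c₂ ≫ r) ≫ k = c₂ := by
    rw [Category.assoc, hrk]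
    simp only [Preadditive.comp_sub, Category.comp_id]
    rw [reassoc_of% hc₂c, Limits.zero_comp, sub_zero]
  have hker : ∀ {W : C} {f : W ⟶ Z'},
      f ∈ HomSub.ker (K := K) (k ≫ c ≫ q) W ↔ f ≫ k ∈ HomSub.ker (K := K) c W := by
    intro W f
    rw [HomSub.mem_ker, HomSub.mem_ker, Category.assoc]
    constructor
    · intro h
      rw [← hc'j, ← Category.assoc, h, Limits.zero_comp]
    · intro h
      rw [reassoc_of% h, Limits.zero_comp]
  have hcover₂ : IsKoszulCover (HomSub.ker (K := K) (k ≫ c ≫ q)) (c₂ ≫ r) := by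
    constructor
    · intro W f
      rw [hker, hc₂.mem_iff]
      constructor
      · rintro ⟨g, hg⟩
        exact ⟨g, by rw [← Category.assoc, hg, Category.assoc, hkr, Category.comp_id]⟩
      · rintro ⟨g, rfl⟩
        exact ⟨g, by rw [Category.assoc g, hc₂k]⟩
    · intro i hi W f
      rw [hker]
      constructor
      · rintro ⟨hf, hfS⟩
        obtain ⟨g, hg, hgf⟩ := (hc₂.rad_iff hi).1 ⟨radPow_comp_right K (i + 1) hf k, hfS⟩
        exact ⟨g, hg, by rw [← Category.assoc, hgf, Category.assoc, hkr, Category.comp_id]⟩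
      · rintro ⟨g, hg, rfl⟩
        have h := (hc₂.rad_iff hi).2 ⟨g, hg, rfl⟩
        refine ⟨?_, ?_⟩
        · have := radPow_comp_right K (i + 1) h.1 r
          simpa only [Category.assoc] using this
        · rw [Category.assoc g, hc₂k]
          exact h.2
  refine .of_cover hcover (.of_cover hcover₂ ?_)
  have : HomSub.ker (K := K) (c₂ ≫ r) = HomSub.ker c₂ := by
    funext W
    ext f
    rw [HomSub.mem_ker, HomSub.mem_ker]
    constructor
    · intro h
      rw [← hc₂k, ← Category.assoc, h, Limits.zero_comp]
    · intro h
      rw [reassoc_of% h, Limits.zero_comp]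
  rwa [this]

/-- Removing a summand from a finite direct sum. -/
theorem IsDirectSum.succAbove {n : ℕ} {Y : Fin (n + 1) → C} {X : C} {ι : ∀ i, Y i ⟶ X}
    {π : ∀ i, X ⟶ Y i} (h : IsDirectSum Y X ι π) (i : Fin (n + 1)) {X' : C} {j : X' ⟶ X}
    {q : X ⟶ X'} (hjq : j ≫ q = 𝟙 X') (hqj : q ≫ j = 𝟙 X - π i ≫ ι i) :
    IsDirectSum (fun m => Y (i.succAbove m)) X' (fun m => ι (i.succAbove m) ≫ q)
      (fun m => j ≫ π (i.succAbove m)) := by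
  obtain ⟨h1, h2, h3⟩ := h
  have key : ∀ m l, (ι (i.succAbove m) ≫ q) ≫ j ≫ π (i.succAbove l) =
      ι (i.succAbove m) ≫ π (i.succAbove l) := by
    intro m l
    have h0 : ι (i.succAbove m) ≫ π i = 0 := h2 _ _ (Fin.succAbove_ne i m)
    rw [Category.assoc, reassoc_of% hqj]
    simp only [Preadditive.sub_comp, Preadditive.comp_sub, Category.id_comp, Category.assoc]
    rw [reassoc_of% h0, Limits.zero_comp, sub_zero]
  refine ⟨fun m => ?_, fun m l hml => ?_, ?_⟩
  · rw [key, h1]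
  · rw [key, h2 _ _ (fun h => hml (Fin.succAbove_right_injective h))]
  · rw [Fin.sum_univ_succAbove _ i] at h3
    have h4 : ∑ m, π (i.succAbove m) ≫ ι (i.succAbove m) = q ≫ j := by
      rw [hqj, ← h3, add_sub_cancel_left]
    calc ∑ m, (j ≫ π (i.succAbove m)) ≫ ι (i.succAbove m) ≫ q
        = j ≫ (∑ m, π (i.succAbove m) ≫ ι (i.succAbove m)) ≫ q := by
          simp only [Preadditive.sum_comp, Preadditive.comp_sum, Category.assoc]
      _ = 𝟙 X' := by rw [h4, Category.assoc, hjq, Category.comp_id, hjq]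

/-- Over a finite direct sum of objects with local endomorphism rings, a Koszul resolution
restricts to a minimal one on a direct summand whose complement lies in `S`. -/
theorem HasKoszulResolution.exists_minimal [IsIdempotentComplete C] (n : ℕ) :
    ∀ {X : C} {S : HomSub K X} (_ : HasKoszulResolution S) {Y : Fin n → C} {ι : ∀ i, Y i ⟶ X}
      {π : ∀ i, X ⟶ Y i} (_ : IsDirectSum Y X ι π) (_ : ∀ i, IsLocalRing (End (Y i))),
      ∃ (X' : C) (j : X' ⟶ X) (p : X ⟶ X'), j ≫ p = 𝟙 X' ∧ 𝟙 X - p ≫ j ∈ S X ∧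
        HasMinimalKoszulResolution (HomSub.comap j S) := by
  induction n with
  | zero =>
    intro X S hS Y ι π hY _
    obtain ⟨Z, c, hc, hZ⟩ := hS.exists_cover
    refine ⟨X, 𝟙 X, 𝟙 X, Category.comp_id _, ?_, Z, c, ?_, ?_, hZ⟩
    · rw [Category.comp_id, sub_self]
      exact zero_mem _
    · have h0 : 𝟙 X = 0 := by rw [← hY.2.2, Finset.univ_eq_empty, Finset.sum_empty]
      rw [← Category.comp_id c, h0, Limits.comp_zero]
      exact zero_mem _
    · have : HomSub.comap (𝟙 X) S = S := by
        funext W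
        ext f
        rw [HomSub.mem_comap, Category.comp_id]
      rwa [this]
  | succ n ih =>
    intro X S hS Y ι π hY hloc
    obtain ⟨Z, c, hc, hZ⟩ := hS.exists_cover
    by_cases hcrad : c ∈ rad K Z X
    · refine ⟨X, 𝟙 X, 𝟙 X, Category.comp_id _, ?_, Z, c, hcrad, ?_, hZ⟩
      · rw [Category.comp_id, sub_self]
        exact zero_mem _
      · have : HomSub.comap (𝟙 X) S = S := by
          funext W
          ext f
          rw [HomSub.mem_comap, Category.comp_id]
        rwa [this]
    obtain ⟨i, hi⟩ : ∃ i, c ≫ π i ∉ rad K Z (Y i) := by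
      by_contra! h
      apply hcrad
      rw [← Category.comp_id c, ← hY.2.2, Preadditive.comp_sum]
      refine Submodule.sum_mem _ fun i _ => ?_
      rw [← Category.assoc]
      exact rad_comp_right K (h i) _
    have := hloc i
    obtain ⟨a, ha⟩ := exists_section_of_notMem_rad K hi
    have hιπ := hY.1 i
    obtain ⟨X₁, j, q, hjq, hqj⟩ := IsIdempotentComplete.idempotents_split X (𝟙 X - π i ≫ ι i)
      (by simp [reassoc_of% hιπ])
    obtain ⟨Z₁, k, r, hkr, hrk⟩ := IsIdempotentComplete.idempotents_split Z (𝟙 Z - c ≫ π i ≫ a)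
      (by simp [reassoc_of% ha])
    have hjπ : j ≫ π i = 0 := by
      have h : j ≫ q ≫ j ≫ π i = j ≫ π i := by rw [← Category.assoc, hjq, Category.id_comp]
      rw [← h, reassoc_of% hqj]
      simp [hιπ]
    -- the projection onto the complement along the image of `a ≫ c`, which lies in `S`
    obtain ⟨p, hp⟩ : ∃ p : X ⟶ X₁, p = (𝟙 X - π i ≫ a ≫ c) ≫ q := ⟨_, rfl⟩
    have hjp : j ≫ p = 𝟙 X₁ := by
      rw [hp]
      simp only [Preadditive.sub_comp, Preadditive.comp_sub, Category.id_comp, Category.assoc]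
      rw [reassoc_of% hjπ, Limits.zero_comp, sub_zero, hjq]
    have hpj : 𝟙 X - p ≫ j = (π i ≫ a) ≫ c := by
      rw [hp]
      simp only [Preadditive.sub_comp, Preadditive.comp_sub, Category.id_comp, Category.assoc,
        hqj, Category.comp_id]
      rw [reassoc_of% ha]
      abel
    obtain ⟨X', j', p', hjp', hpj', hmin⟩ :=
      ih (HasKoszulResolution.remove_summand hc hZ ha hjq hqj hjπ hkr hrk)
        (hY.succAbove i hjq hqj) (fun m => hloc _)
    refine ⟨X', j' ≫ j, p ≫ p', ?_, ?_, ?_⟩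
    · rw [Category.assoc, reassoc_of% hjp, hjp']
    · have hS1 : 𝟙 X - p ≫ j ∈ S X := hc.mem_iff.2 ⟨_, hpj.symm⟩
      obtain ⟨g, hg⟩ := hc.mem_iff.1 (HomSub.mem_comap.1 hpj')
      have hS2 : p ≫ (𝟙 X₁ - p' ≫ j') ≫ j ∈ S X :=
        hc.mem_iff.2 ⟨p ≫ g, by rw [Category.assoc, hg]⟩
      have hsum : 𝟙 X - (p ≫ p') ≫ j' ≫ j =
          (𝟙 X - p ≫ j) + p ≫ (𝟙 X₁ - p' ≫ j') ≫ j := by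
        simp only [Preadditive.sub_comp, Preadditive.comp_sub, Category.id_comp, Category.assoc]
        abel
      rw [hsum]
      exact add_mem hS1 hS2
    · have : HomSub.comap (j' ≫ j) S = HomSub.comap j' (HomSub.comap j S) := by
        funext W
        ext f
        rw [HomSub.mem_comap, HomSub.mem_comap, HomSub.mem_comap, Category.assoc]
      rwa [this]

/-- In a minimal Koszul resolution, the first syzygy may be chosen to be minimal as well. -/
theorem HasMinimalKoszulResolution.exists_cover [IsIdempotentComplete C] (hKS : IsKrullSchmidt C)
    {X : C} {S : HomSub K X} (h : HasMinimalKoszulResolution S) :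
    ∃ (Z : C) (c : Z ⟶ X), c ∈ rad K Z X ∧ IsKoszulCover S c ∧
      HasMinimalKoszulResolution (HomSub.ker (K := K) c) := by
  obtain ⟨Z, c, hcrad, hc, hZ⟩ := h
  obtain ⟨n, Y, ⟨ι, π, hY⟩, hloc⟩ := hKS Z
  obtain ⟨Z', j, p, -, hpj, hmin⟩ := hZ.exists_minimal n hY hloc
  have hpjc : p ≫ j ≫ c = c := by
    rw [HomSub.mem_ker, Preadditive.sub_comp, Category.id_comp, sub_eq_zero, Category.assoc] at hpj
    exact hpj.symm
  refine ⟨Z', j ≫ c, rad_comp_left K j hcrad, hc.restrict hpjc, ?_⟩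
  have : HomSub.ker (K := K) (j ≫ c) = HomSub.comap j (HomSub.ker c) := by
    funext W
    ext f
    rw [HomSub.mem_comap, HomSub.mem_ker, HomSub.mem_ker, Category.assoc]
  rwa [this]

/-- The sequence of objects, subfunctors and radical maps given by a minimal Koszul resolution. -/
theorem HasMinimalKoszulResolution.exists_sequence [IsIdempotentComplete C]
    (hKS : IsKrullSchmidt C) {X : C} {S : HomSub K X} (h : HasMinimalKoszulResolution S) :
    ∃ st : ℕ → Σ X : C, HomSub K X, st 0 = ⟨X, S⟩ ∧
      ∃ d : ∀ n, (st (n + 1)).1 ⟶ (st n).1, ∀ n, d n ∈ rad K _ _ ∧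
        IsKoszulCover (st n).2 (d n) ∧ (st (n + 1)).2 = HomSub.ker (d n) := by
  have step : ∀ s : {s : Σ X : C, HomSub K X // HasMinimalKoszulResolution s.2},
      ∃ (t : {s : Σ X : C, HomSub K X // HasMinimalKoszulResolution s.2})
        (c : t.1.1 ⟶ s.1.1), c ∈ rad K _ _ ∧ IsKoszulCover s.1.2 c ∧
          t.1.2 = HomSub.ker c := by
    rintro ⟨⟨X, S⟩, h⟩
    obtain ⟨Z, c, hcrad, hc, hZ⟩ := h.exists_cover hKS
    exact ⟨⟨⟨Z, HomSub.ker c⟩, hZ⟩, c, hcrad, hc, rfl⟩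
  choose next c hc using step
  let st : ℕ → {s : Σ X : C, HomSub K X // HasMinimalKoszulResolution s.2} :=
    fun n => Nat.rec ⟨⟨X, S⟩, h⟩ (fun _ s => next s) n
  exact ⟨fun n => (st n).1, rfl, fun n => c (st n), fun n => hc (st n)⟩

end Cover

/-! ### Exactness of maps of associated graded vector spaces -/

section Filtered

variable {K : Type w} [Field K]
variable {A B M : Type v} [AddCommGroup A] [Module K A] [AddCommGroup B] [Module K B]
  [AddCommGroup M] [Module K M]

theorem GrMod.mk_eq_zero {V : ℕ → Submodule K A} {i : ℕ} {a : A} (ha : a ∈ V i) :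
    GrMod.mk V i ⟨a, ha⟩ = 0 ↔ a ∈ V (i + 1) := by
  classical
  rw [GrMod.mk, LinearMap.comp_apply, ← map_zero (DirectSum.lof K ℕ (GrPiece V) i)]
  refine (DirectSum.of_injective (β := GrPiece V) i).eq_iff.trans ?_
  rw [Submodule.mkQ_apply, Submodule.Quotient.mk_eq_zero]
  rfl

theorem GrMod.mk_eq_mk {V : ℕ → Submodule K A} {i : ℕ} {a b : A} (ha : a ∈ V i) (hb : b ∈ V i) :
    GrMod.mk V i ⟨a, ha⟩ = GrMod.mk V i ⟨b, hb⟩ ↔ a - b ∈ V (i + 1) := by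
  classical
  refine (DirectSum.of_injective (β := GrPiece V) i).eq_iff.trans ?_
  rw [Submodule.mkQ_apply, Submodule.mkQ_apply, Submodule.Quotient.eq]
  rfl

theorem GrMod.lof_component_mk_self (V : ℕ → Submodule K A) (i : ℕ) (a : V i) :
    DirectSum.lof K ℕ (GrPiece V) i (DirectSum.component K ℕ (GrPiece V) i (GrMod.mk V i a)) =
      GrMod.mk V i a := by
  rw [GrMod.mk, LinearMap.comp_apply, DirectSum.component.lof_self]

theorem GrMod.component_mk_of_ne (V : ℕ → Submodule K A) {i j : ℕ} (h : i ≠ j) (a : V i) :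
    DirectSum.component K ℕ (GrPiece V) j (GrMod.mk V i a) = 0 := by
  rw [GrMod.mk, LinearMap.comp_apply, DirectSum.component.of, dif_neg h]

/-- Exactness for maps of associated graded vector spaces which are induced, with degree shifts
`k` and `l`, by maps `α` and `β` of filtered vector spaces. -/
theorem GrMod.exact_of_filtered {V : ℕ → Submodule K A} {W : ℕ → Submodule K B}
    {U : ℕ → Submodule K M} (α : A →ₗ[K] B) (β : B →ₗ[K] M) (k l : ℕ)
    (φ : GrMod V →ₗ[K] GrMod W) (ψ : GrMod W →ₗ[K] GrMod U)
    (hα : ∀ i, ∀ a ∈ V i, α a ∈ W (i + k)) (hβ : ∀ i, ∀ b ∈ W i, β b ∈ U (i + l))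
    (hφ : ∀ i a (ha : a ∈ V i), φ (GrMod.mk V i ⟨a, ha⟩) = GrMod.mk W (i + k) ⟨α a, hα i a ha⟩)
    (hψ : ∀ i b (hb : b ∈ W i), ψ (GrMod.mk W i ⟨b, hb⟩) = GrMod.mk U (i + l) ⟨β b, hβ i b hb⟩)
    (hβα : ∀ a, β (α a) = 0)
    (h : ∀ i, ∀ b ∈ W i, β b ∈ U (i + l + 1) →
      b ∈ W (i + 1) ∨ ∃ j a, j + k = i ∧ a ∈ V j ∧ b - α a ∈ W (i + 1)) :
    Function.Exact φ ψ := by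
  classical
  intro x
  constructor
  · intro hx
    have hcomp : ∀ (i : ℕ) (x : GrMod W),
        ψ (DirectSum.lof K ℕ (GrPiece W) i (DirectSum.component K ℕ (GrPiece W) i x)) =
        DirectSum.lof K ℕ (GrPiece U) (i + l)
          (DirectSum.component K ℕ (GrPiece U) (i + l) (ψ x)) := by
      intro i x
      induction x using GrMod.induction with
      | zero => simp only [map_zero]
      | add x y hx hy => simp only [map_add, hx, hy]
      | mk m b hb =>
        by_cases hm : m = i
        · subst hm
          rw [GrMod.lof_component_mk_self, hψ, GrMod.lof_component_mk_self]
        · rw [hψ, GrMod.component_mk_of_ne W hm,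
            GrMod.component_mk_of_ne U (fun h => hm (Nat.add_right_cancel h)),
            map_zero, map_zero, map_zero]
    rw [← DirectSum.sum_support_of x]
    refine (LinearMap.range φ).sum_mem fun i _ => ?_
    have hi := hcomp i x
    rw [hx, map_zero, map_zero] at hi
    change DirectSum.lof K ℕ (GrPiece W) i (DirectSum.component K ℕ (GrPiece W) i x) ∈
      LinearMap.range φ
    obtain ⟨⟨b, hb⟩, hbx⟩ :=
      Submodule.mkQ_surjective _ (DirectSum.component K ℕ (GrPiece W) i x)
    rw [← hbx] at hi ⊢
    change GrMod.mk W i ⟨b, hb⟩ ∈ _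
    replace hi : ψ (GrMod.mk W i ⟨b, hb⟩) = 0 := hi
    rw [hψ, GrMod.mk_eq_zero] at hi
    obtain hb' | ⟨j, a, rfl, ha, hba⟩ := h i b hb hi
    · rw [(GrMod.mk_eq_zero hb).2 hb']
      exact zero_mem _
    · refine ⟨GrMod.mk V j ⟨a, ha⟩, ?_⟩
      rw [hφ, eq_comm]
      exact (GrMod.mk_eq_mk hb (hα j a ha)).2 hba
  · rintro ⟨y, rfl⟩
    induction y using GrMod.induction with
    | zero => simp only [map_zero]
    | add x y hx hy => rw [map_add, map_add, hx, hy, add_zero]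
    | mk i a ha =>
      rw [hφ, hψ, GrMod.mk_eq_zero, hβα]
      exact zero_mem _

end Filtered

/-! ### Representable functors and generators -/

section Functors

variable {K : Type w} [Field K] {C : Type u} [Category.{v} C] [Preadditive C] [Linear K C]

theorem ModC.act_id (F : ModC K C) {X : C} (x : F.ev X) : F.act X X (𝟙 X) x = x := by
  change (F.obj.map (𝟙 X).op).hom x = x
  rw [op_id, F.obj.map_id]
  rfl

theorem ModC.act_comp (F : ModC K C) {X Y Z : C} (f : X ⟶ Y) (g : Y ⟶ Z) (x : F.ev Z) :
    F.act X Z (f ≫ g) x = F.act X Y f (F.act Y Z g x) := by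
  change (F.obj.map (f ≫ g).op).hom x = (F.obj.map f.op).hom ((F.obj.map g.op).hom x)
  rw [op_comp, F.obj.map_comp, ModuleCat.hom_comp, LinearMap.comp_apply]

theorem ModC.app_act {F G : ModC K C} (η : F ⟶ G) {X Y : C} (f : X ⟶ Y) (y : F.ev Y) :
    ModC.app η X (F.act X Y f y) = G.act X Y f (ModC.app η Y y) :=
  congrArg (fun t => t.hom y) (η.hom.naturality f.op)

/-- The morphism `Hom(-, X) ⟶ F` which corresponds to an element of `F(X)`. -/
def ModC.ofElement (F : ModC K C) {X : C} (x : F.ev X) : repr K X ⟶ F :=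
  ObjectProperty.homMk
    { app := fun Y => ModuleCat.ofHom ((F.act Y.unop X).flip x)
      naturality := fun Y Z f => by
        refine ModuleCat.hom_ext (LinearMap.ext fun g => ?_)
        exact F.act_comp f.unop g x }

theorem ModC.app_eq_act {F : ModC K C} {X : C} (η : repr K X ⟶ F) {Y : C} (f : Y ⟶ X) :
    ModC.app η Y f = F.act Y X f (ModC.app η X (𝟙 X)) := by
  rw [← ModC.app_act η f (show (repr K X).ev X from 𝟙 X)]
  exact congrArg (ModC.app η Y) (Category.comp_id f).symm

/-- If the element `s` generates the subfunctor `S`, then `rad^i S` consists of the multiples of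
`s` by maps in `rad^i`. -/
theorem mem_radMul_iff {F : ModC K C} {S : F.Sub} {X : C} {s : F.ev X} (hs : s ∈ S X)
    (hgen : ∀ (Y : C), ∀ y ∈ S Y, ∃ f : Y ⟶ X, F.act Y X f s = y) {i : ℕ} {Y : C} {y : F.ev Y} :
    y ∈ radMul i S Y ↔ ∃ f ∈ radPow K i Y X, F.act Y X f s = y := by
  constructor
  · have h : radMul i S Y ≤ (radPow K i Y X).map ((F.act Y X).flip s) := by
      refine iSup_le fun Z => iSup_le fun g => ?_
      rintro _ ⟨z, hz, rfl⟩
      obtain ⟨f, rfl⟩ := hgen Z z hz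
      exact ⟨g.1 ≫ f, radPow_comp_right K i g.2 f, F.act_comp g.1 f s⟩
    exact fun hy => h hy
  · rintro ⟨f, hf, rfl⟩
    exact Submodule.mem_iSup_of_mem X (Submodule.mem_iSup_of_mem ⟨f, hf⟩ ⟨s, hs, rfl⟩)

theorem mem_radFilt_iff {F : ModC K C} {X : C} {s : F.ev X}
    (hgen : ∀ (Y : C) (y : F.ev Y), ∃ f : Y ⟶ X, F.act Y X f s = y) {i : ℕ} {Y : C}
    {y : F.ev Y} : y ∈ radFilt F Y i ↔ ∃ f ∈ radPow K i Y X, F.act Y X f s = y :=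
  mem_radMul_iff (S := fun _ => ⊤) trivial (fun Y y _ => hgen Y y)

/-- Finitely generated projective functors are representable, since idempotents split. -/
theorem exists_representing_element [IsIdempotentComplete C] {P : ModC K C} (hfg : P.IsFG)
    [Projective P] :
    ∃ (X : C) (p : P.ev X), ∀ Y, Function.Bijective fun f : Y ⟶ X => P.act Y X f p := by
  obtain ⟨X, η, hη⟩ := hfg
  have : Epi η := by
    constructor
    intro Z g h hgh
    refine ObjectProperty.hom_ext _ (NatTrans.ext (funext fun Y => ?_))
    refine ModuleCat.hom_ext (LinearMap.ext fun y => ?_)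
    obtain ⟨x, rfl⟩ := hη Y.unop y
    exact congrArg (fun t : repr K X ⟶ Z => ModC.app t Y.unop x) hgh
  obtain ⟨σ, hσ⟩ : ∃ σ : P ⟶ repr K X, σ ≫ η = 𝟙 P :=
    ⟨Projective.factorThru (𝟙 P) η, Projective.factorThru_comp _ _⟩
  have hση : ∀ (Y : C) (y : P.ev Y), ModC.app η Y (ModC.app σ Y y) = y := fun Y y =>
    congrArg (fun t : P ⟶ P => ModC.app t Y y) hσ
  obtain ⟨x, hx⟩ : ∃ x : P.ev X, ModC.app η X (𝟙 X) = x := ⟨_, rfl⟩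
  -- the idempotent endomorphism of `X` which corresponds to `η ≫ σ`
  obtain ⟨e, he⟩ : ∃ e : X ⟶ X, ModC.app σ X x = e := ⟨_, rfl⟩
  have hηx : ∀ {Y : C} (f : Y ⟶ X), ModC.app η Y f = P.act Y X f x := fun f => by
    rw [ModC.app_eq_act, hx]
  have hσf : ∀ {Y : C} (f : Y ⟶ X), ModC.app σ Y (P.act Y X f x) = f ≫ e := fun f => by
    rw [ModC.app_act, he]
    rfl
  have hex : P.act X X e x = x := by rw [← hηx, ← he, hση]
  have hee : e ≫ e = e := by rw [← hσf, hex, he]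
  obtain ⟨X', j, q, hjq, hqj⟩ := IsIdempotentComplete.idempotents_split X e hee
  refine ⟨X', P.act X' X j x, fun Y => ⟨fun f g hfg => ?_, fun y => ?_⟩⟩
  · have h := congrArg (ModC.app σ Y) hfg
    simp only [← ModC.act_comp, hσf] at h
    have h' := congrArg (· ≫ q) h
    simpa only [← hqj, Category.assoc, hjq, Category.comp_id, reassoc_of% hjq] using h'
  · refine ⟨(show Y ⟶ X from ModC.app σ Y y) ≫ q, ?_⟩
    change P.act Y X' _ _ = y
    rw [← ModC.act_comp, Category.assoc, hqj, ModC.act_comp, hex, ← hηx, hση]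

/-- The kernel of the map `Hom(-, X) ⟶ F` given by an element of `F(X)`. -/
def ModC.annihilator (F : ModC K C) {X : C} (x : F.ev X) : HomSub K X :=
  fun Y => LinearMap.ker ((F.act Y X).flip x)

theorem ModC.mem_annihilator {F : ModC K C} {X : C} {x : F.ev X} {Y : C} {f : Y ⟶ X} :
    f ∈ F.annihilator x Y ↔ F.act Y X f x = 0 := Iff.rfl

/-- The weak Koszul condition on the syzygy of a functor `F` covered by a functor `P`, when `P` and
the functor `Q` covering the syzygy are representable. -/
theorem isKoszulCover_of_exact {Q P F : ModC K C} {η : Q ⟶ P} {ε : P ⟶ F}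
    (hex : ∀ Y, Function.Exact (ModC.app η Y) (ModC.app ε Y))
    (hrad : ∀ (Y : C) (i : ℕ), 1 ≤ i →
      radFilt P Y (i + 1) ⊓ ModC.ker ε Y = radMul i (ModC.ker ε) Y)
    {X Z : C} {p : P.ev X} {q : Q.ev Z}
    (hp : ∀ Y, Function.Bijective fun f : Y ⟶ X => P.act Y X f p)
    (hq : ∀ Y, Function.Bijective fun f : Y ⟶ Z => Q.act Y Z f q) :
    ∃ c : Z ⟶ X, P.act Z X c p = ModC.app η Z q ∧
      IsKoszulCover (F.annihilator (ModC.app ε X p)) c := by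
  obtain ⟨c, hc⟩ := (hp Z).2 (ModC.app η Z q)
  replace hc : P.act Z X c p = ModC.app η Z q := hc
  have hact : ∀ {Y : C} (f : Y ⟶ X),
      f ∈ F.annihilator (ModC.app ε X p) Y ↔ ModC.app ε Y (P.act Y X f p) = 0 := by
    intro Y f
    rw [ModC.mem_annihilator, ModC.app_act]
  have hpull : ∀ {Y : C} (g : Y ⟶ Z) (f : Y ⟶ X),
      g ≫ c = f ↔ P.act Y Z g (P.act Z X c p) = P.act Y X f p := by
    intro Y g f
    rw [← ModC.act_comp]
    exact ⟨fun h => by rw [h], fun h => (hp Y).1 h⟩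
  have hgen : ∀ (Y : C), ∀ y ∈ ModC.ker ε Y, ∃ g : Y ⟶ Z, P.act Y Z g (P.act Z X c p) = y := by
    intro Y y hy
    obtain ⟨z, rfl⟩ := (hex Y y).1 hy
    obtain ⟨g, rfl⟩ := (hq Y).2 z
    exact ⟨g, by rw [hc, ModC.app_act]⟩
  have hcker : P.act Z X c p ∈ ModC.ker ε Z := by
    rw [hc]
    exact (hex Z).apply_apply_eq_zero q
  refine ⟨c, hc, ?_, ?_⟩
  · intro Y f
    rw [hact]
    constructor
    · intro h
      obtain ⟨g, hg⟩ := hgen Y _ h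
      exact ⟨g, (hpull g f).2 hg⟩
    · rintro ⟨g, hg⟩
      rw [← (hpull g f).1 hg, ModC.app_act, show ModC.app ε Z (P.act Z X c p) = 0 from hcker,
        map_zero]
  · intro i hi Y f
    have h1 : f ∈ radPow K (i + 1) Y X ↔ P.act Y X f p ∈ radFilt P Y (i + 1) := by
      rw [mem_radFilt_iff (fun Y => (hp Y).2)]
      exact ⟨fun h => ⟨f, h, rfl⟩, fun ⟨f', h, h'⟩ => (hp Y).1 h' ▸ h⟩
    rw [h1, hact]
    change P.act Y X f p ∈ radFilt P Y (i + 1) ⊓ ModC.ker ε Y ↔ _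
    rw [hrad Y i hi, mem_radMul_iff hcker hgen]
    simp only [hpull]

/-- A weakly Koszul functor is generated by an element whose annihilator has a Koszul
resolution. -/
theorem IsWeaklyKoszul.exists_generator [IsIdempotentComplete C] {F : ModC K C}
    (h : IsWeaklyKoszul F) :
    ∃ (X : C) (e : F.ev X), (∀ (Y : C) (y : F.ev Y), ∃ f : Y ⟶ X, F.act Y X f e = y) ∧
      HasKoszulResolution (F.annihilator e) := by
  obtain ⟨P, d, ε, hfg, hproj, hex, hrad₀, hrad⟩ := h
  have hrep := fun n => exists_representing_element (hfg n) (P := P n)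
  choose X p hp using hrep
  refine ⟨X 0, ModC.app ε _ (p 0), fun Y y => ?_, ?_⟩
  · obtain ⟨x, rfl⟩ := (hex Y).1 y
    obtain ⟨f, rfl⟩ := (hp 0 Y).2 x
    exact ⟨f, (ModC.app_act _ _ _).symm⟩
  have hker : ∀ (Q : ModC K C) {Z W : C} {q : Q.ev W} {c : Z ⟶ W}
      (_ : ∀ Y, Function.Bijective fun f : Y ⟶ W => Q.act Y W f q),
      HomSub.ker (K := K) c = Q.annihilator (Q.act Z W c q) := by
    intro Q Z W q c hq
    funext Y
    ext f
    rw [HomSub.mem_ker, ModC.mem_annihilator, ← ModC.act_comp]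
    refine ⟨fun h => by rw [h, map_zero, LinearMap.zero_apply], fun h => (hq Y).1 ?_⟩
    change Q.act Y W (f ≫ c) q = Q.act Y W 0 q
    rw [h, map_zero, LinearMap.zero_apply]
  obtain ⟨c, hc, hcover⟩ :=
    isKoszulCover_of_exact (fun Y => (hex Y).2.1) hrad₀ (hp 0) (hp 1)
  refine .of_cover hcover ⟨fun Z S => ∃ (n : ℕ) (hZ : Z = X (n + 1)),
    S = hZ ▸ (P n).annihilator (ModC.app (d n) _ (p (n + 1))), ?_, 0, rfl, ?_⟩
  · rintro _ _ ⟨n, rfl, rfl⟩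
    obtain ⟨c, hc, hcover⟩ :=
      isKoszulCover_of_exact (fun Y => (hex Y).2.2 n) (hrad n) (hp (n + 1)) (hp (n + 2))
    refine ⟨_, c, hcover, n + 1, rfl, ?_⟩
    rw [hker _ (hp (n + 1)), hc]
  · rw [hker _ (hp 0), hc]

end Functors

/-! ### Linearity of the associated graded functor -/

section Linear

variable {K : Type w} [Field K] {C : Type u} [Category.{v} C] [Preadditive C] [Linear K C]

/-- The class of an element of `rad^i(X, Y)`, as a map of degree `i` in `A_gr(C)`. -/
def AGr.class {X Y : C} (i : ℕ) (f : X ⟶ Y) (hf : f ∈ radPow K i X Y) :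
    (⟨X⟩ : AGr K C) ⟶ ⟨Y⟩ :=
  GrMod.mk (homFilt K X Y) i ⟨f, hf⟩

theorem AGr.class_mem_deg {X Y : C} (i : ℕ) (f : X ⟶ Y) (hf : f ∈ radPow K i X Y) :
    AGr.class i f hf ∈ GradedCategory.deg (K := K) (⟨X⟩ : AGr K C) ⟨Y⟩ i :=
  mk_mem_grDeg _ _ _

theorem IsKoszulCover.comp_eq_zero {X Z W : C} {c : Z ⟶ X} {c' : W ⟶ Z}
    (h : IsKoszulCover (HomSub.ker (K := K) c) c') : c' ≫ c = 0 :=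
  HomSub.mem_ker.1 (h.mem_iff.2 ⟨𝟙 _, Category.id_comp _⟩)

/-- For a radical Koszul cover `c` of `S`, a map in `rad^i ∩ S` agrees modulo `rad^(i+1)` with
`0` or with a multiple of `c` by a map in `rad^(i-1)`. -/
theorem IsKoszulCover.mem_radPow_succ_or {X Z : C} {S : HomSub K X} {c : Z ⟶ X}
    (hc : IsKoszulCover S c) (hrad : c ∈ rad K Z X) {i : ℕ} {Y : C} {f : Y ⟶ X}
    (hf : f ∈ radPow K i Y X) (hfS : f ∈ S Y) :
    f ∈ radPow K (i + 1) Y X ∨ ∃ (j : ℕ) (g : Y ⟶ Z), j + 1 = i ∧ g ∈ radPow K j Y Z ∧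
      g ≫ c = f := by
  match i with
  | 0 =>
    left
    obtain ⟨g, rfl⟩ := hc.mem_iff.1 hfS
    rw [radPow_one]
    exact rad_comp_left K g hrad
  | 1 =>
    obtain ⟨g, rfl⟩ := hc.mem_iff.1 hfS
    exact Or.inr ⟨0, g, rfl, trivial, rfl⟩
  | i + 2 =>
    obtain ⟨g, hg, hgf⟩ := (hc.rad_iff (Nat.succ_le_succ (Nat.zero_le i))).1 ⟨hf, hfS⟩
    exact Or.inr ⟨i + 1, g, rfl, hg, hgf⟩

/-- If the annihilator of a generator of `F` has a minimal Koszul resolution, then `G(F)` is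
linear: the classes in degree one of the maps in the resolution form a linear resolution. -/
theorem isLinear_assocGraded [IsIdempotentComplete C] (hKS : IsKrullSchmidt C) {F : ModC K C}
    {X : C} {e : F.ev X} (hgen : ∀ (Y : C) (y : F.ev Y), ∃ f : Y ⟶ X, F.act Y X f e = y)
    (hmin : HasMinimalKoszulResolution (F.annihilator e)) : IsLinear (assocGraded F) := by
  obtain ⟨st, hst, d, hd⟩ := hmin.exists_sequence hKS
  obtain ⟨e, hgen, hann⟩ : ∃ e : F.ev (st 0).1,
      (∀ (Y : C) (y : F.ev Y), ∃ f : Y ⟶ (st 0).1, F.act Y _ f e = y) ∧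
        (st 0).2 = F.annihilator e := by
    rw [hst]
    exact ⟨e, hgen, rfl⟩
  have hd1 : ∀ n, d n ∈ radPow K 1 _ _ := fun n => by
    rw [radPow_one]
    exact (hd n).1
  have he0 : e ∈ radFilt F (st 0).1 0 :=
    (mem_radFilt_iff hgen).2 ⟨𝟙 _, trivial, F.act_id e⟩
  have hcover : ∀ n, IsKoszulCover (HomSub.ker (K := K) (d n)) (d (n + 1)) := fun n => by
    rw [← (hd n).2.2]
    exact (hd (n + 1)).2.1
  have hcover₀ : IsKoszulCover (F.annihilator e) (d 0) := hann ▸ (hd 0).2.1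
  have hd0 : F.act _ _ (d 0) e = 0 :=
    ModC.mem_annihilator.1 (hcover₀.mem_iff.2 ⟨𝟙 _, Category.id_comp _⟩)
  refine ⟨fun n => ⟨(st n).1⟩,
    fun n => ModC.ofElement (repr K (⟨(st n).1⟩ : AGr K C)) (AGr.class 1 (d n) (hd1 n)),
    ModC.ofElement (agrMod F) (X := ⟨(st 0).1⟩) (GrMod.mk (radFilt F (st 0).1) 0 ⟨e, he0⟩),
    ?_, ?_, ?_⟩
  · intro n Y j x hx
    have h := GradedCategory.comp_mem (K := K) (D := AGr K C) hx
      (AGr.class_mem_deg 1 (d n) (hd1 n))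
    have hdeg : -((n + 1 : ℕ) : ℤ) + j + ((1 : ℕ) : ℤ) = -(n : ℤ) + j := by
      push_cast
      ring
    rw [hdeg] at h
    exact h
  · intro Y j x hx
    have h := agrAct_mem_grDeg F hx (mk_mem_grDeg (radFilt F (st 0).1) 0 ⟨e, he0⟩)
    rw [Nat.cast_zero, add_zero] at h
    exact h
  · rintro ⟨Y⟩
    refine ⟨?_, ?_, ?_⟩
    · intro y
      induction y using GrMod.induction with
      | zero => exact ⟨0, map_zero _⟩
      | add x y hx hy =>
        obtain ⟨a, rfl⟩ := hx
        obtain ⟨b, rfl⟩ := hy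
        exact ⟨a + b, map_add _ _ _⟩
      | mk i y hy =>
        obtain ⟨f, hf, rfl⟩ := (mem_radFilt_iff hgen).1 hy
        exact ⟨GrMod.mk (homFilt K Y _) i ⟨f, hf⟩, agrAct_mk F hf he0⟩
    · refine GrMod.exact_of_filtered (V := homFilt K Y (st 1).1) (W := homFilt K Y (st 0).1)
        (U := radFilt F Y) (Linear.rightComp K Y (d 0)) ((F.act Y (st 0).1).flip e) 1 0 _ _
        (fun i f hf => radPow_comp K i hf 1 (hd1 0))
        (fun i f hf => act_mem_radFilt F i 0 f hf e he0)
        (fun i f hf => agrComp_mk K hf (hd1 0)) (fun i f hf => agrAct_mk F hf he0) ?_ ?_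
      · intro f
        change F.act Y _ (f ≫ d 0) e = 0
        rw [ModC.act_comp, hd0, map_zero]
      · intro i f hf hfe
        obtain ⟨g, hg, hgf⟩ := (mem_radFilt_iff hgen).1 hfe
        have hfg : f - g ∈ F.annihilator e Y := by
          rw [ModC.mem_annihilator, map_sub, LinearMap.sub_apply, hgf]
          exact sub_self _
        rcases hcover₀.mem_radPow_succ_or (hd 0).1
          (sub_mem hf (radPow_succ_le K i _ _ hg)) hfg with h | ⟨j, a, hj, ha, haf⟩
        · left
          rw [← sub_add_cancel f g]
          exact add_mem h hg
        · right
          refine ⟨j, a, hj, ha, ?_⟩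
          change f - a ≫ d 0 ∈ _
          rw [haf, sub_sub_cancel]
          exact hg
    · intro n
      refine GrMod.exact_of_filtered (V := homFilt K Y (st (n + 2)).1)
        (W := homFilt K Y (st (n + 1)).1) (U := homFilt K Y (st n).1)
        (Linear.rightComp K Y (d (n + 1))) (Linear.rightComp K Y (d n)) 1 1 _ _
        (fun i f hf => radPow_comp K i hf 1 (hd1 (n + 1)))
        (fun i f hf => radPow_comp K i hf 1 (hd1 n))
        (fun i f hf => agrComp_mk K hf (hd1 (n + 1)))
        (fun i f hf => agrComp_mk K hf (hd1 n)) ?_ ?_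
      · intro f
        change (f ≫ d (n + 1)) ≫ d n = 0
        rw [Category.assoc, (hcover n).comp_eq_zero, Limits.comp_zero]
      · intro i f hf hfd
        change f ≫ d n ∈ radPow K (i + 1 + 1) Y _ at hfd
        -- the Koszul condition for `d n` allows `f` to be corrected within `rad^(i+1)`
        obtain ⟨g, hg, hgf⟩ := ((hd n).2.1.rad_iff (Nat.le_add_left 1 i)).1
          ⟨hfd, (hd n).2.1.mem_iff.2 ⟨f, rfl⟩⟩
        have hfg : f - g ∈ HomSub.ker (K := K) (d n) Y := by
          rw [HomSub.mem_ker, Preadditive.sub_comp, hgf, sub_self]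
        rcases (hcover n).mem_radPow_succ_or (hd (n + 1)).1
          (sub_mem hf (radPow_succ_le K i _ _ hg)) hfg with h | ⟨j, a, hj, ha, haf⟩
        · left
          rw [← sub_add_cancel f g]
          exact add_mem h hg
        · right
          refine ⟨j, a, hj, ha, ?_⟩
          change f - a ≫ d (n + 1) ∈ _
          rw [haf, sub_sub_cancel]
          exact hg

theorem IsWeaklyKoszul.isLinear_assocGraded [IsIdempotentComplete C] (hKS : IsKrullSchmidt C)
    {F : ModC K C} (h : IsWeaklyKoszul F) : IsLinear (assocGraded F) := by
  obtain ⟨X, e, hgen, hres⟩ := h.exists_generator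
  obtain ⟨n, Y, ⟨ι, π, hY⟩, hloc⟩ := hKS X
  obtain ⟨X', j, p, -, hpj, hmin⟩ := hres.exists_minimal n hY hloc
  have hpje : F.act X X (p ≫ j) e = e := by
    have h := ModC.mem_annihilator.1 hpj
    rw [map_sub, LinearMap.sub_apply, F.act_id, sub_eq_zero] at h
    exact h.symm
  refine KoszulCat.isLinear_assocGraded hKS (e := F.act X' X j e) (fun Y y => ?_) ?_
  · obtain ⟨f, rfl⟩ := hgen Y y
    exact ⟨f ≫ p, by rw [← F.act_comp, Category.assoc, F.act_comp, hpje]⟩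
  · have : F.annihilator (F.act X' X j e) = HomSub.comap j (F.annihilator e) := by
      funext W
      ext f
      rw [HomSub.mem_comap, ModC.mem_annihilator, ModC.mem_annihilator, F.act_comp]
    rwa [this]

end Linear

/-! ### The associated graded category -/

section AssociatedGradedCategory

variable (K : Type w) [Field K] (C : Type u) [Category.{v} C] [Preadditive C] [Linear K C]

theorem AGr.isPositivelyGraded : IsPositivelyGraded K (AGr K C) := by
  rintro X Y (i | i) hi
  · exact absurd hi (not_lt.2 (Int.natCast_nonneg i))
  · rfl

theorem AGr.isLocallyFinite (hfin : IsLocallyRadicalFinite K C) : IsLocallyFinite K (AGr K C) := by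
  rintro X Y (i | i)
  · have := hfin X.obj Y.obj i
    exact inferInstanceAs (Module.Finite K
      (LinearMap.range (DirectSum.lof K ℕ (GrPiece (homFilt K X.obj Y.obj)) i)))
  · exact inferInstanceAs (Module.Finite K (⊥ : Submodule K (GrMod (homFilt K X.obj Y.obj))))

variable {K C}

theorem AGr.class_comp {X Y Z : C} {i j : ℕ} {f : X ⟶ Y} {g : Y ⟶ Z}
    (hf : f ∈ radPow K i X Y) (hg : g ∈ radPow K j Y Z) :
    AGr.class i f hf ≫ AGr.class j g hg = AGr.class (i + j) (f ≫ g) (radPow_comp K i hf j hg) :=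
  agrComp_mk K hf hg

variable (K) in
/-- The linear map which sends a map of `C` to its class in degree `0`. -/
def AGr.classZero (X Y : C) : (X ⟶ Y) →ₗ[K] ((⟨X⟩ : AGr K C) ⟶ ⟨Y⟩) :=
  GrMod.mk (homFilt K X Y) 0 ∘ₗ LinearMap.codRestrict ⊤ LinearMap.id fun _ => trivial

theorem AGr.classZero_id (X : C) : AGr.classZero K X X (𝟙 X) = 𝟙 _ := rfl

theorem AGr.classZero_comp {X Y Z : C} (f : X ⟶ Y) (g : Y ⟶ Z) :
    AGr.classZero K X Z (f ≫ g) = AGr.classZero K X Y f ≫ AGr.classZero K Y Z g :=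
  (AGr.class_comp (i := 0) (j := 0) trivial trivial).symm

theorem AGr.classZero_mem_deg {X Y : C} (f : X ⟶ Y) :
    AGr.classZero K X Y f ∈ GradedCategory.deg (K := K) (⟨X⟩ : AGr K C) ⟨Y⟩ 0 :=
  mk_mem_grDeg _ 0 _

theorem AGr.classZero_eq_zero {X Y : C} {f : X ⟶ Y} :
    AGr.classZero K X Y f = 0 ↔ f ∈ rad K X Y := by
  rw [← radPow_one]
  exact GrMod.mk_eq_zero (V := homFilt K X Y) (i := 0) trivial

theorem AGr.exists_classZero {X Y : C} {f : (⟨X⟩ : AGr K C) ⟶ ⟨Y⟩}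
    (hf : f ∈ GradedCategory.deg (K := K) (⟨X⟩ : AGr K C) ⟨Y⟩ 0) :
    ∃ f₀ : X ⟶ Y, AGr.classZero K X Y f₀ = f := by
  obtain h | ⟨i, a, ha, hi, h⟩ := exists_of_mem_grDeg hf
  · exact ⟨0, by rw [map_zero]; exact h.symm⟩
  · obtain rfl : i = 0 := by exact_mod_cast hi.symm
    exact ⟨a, h.symm⟩

/-- Direct sums in `C` give direct sums in `A_gr(C)`, with structure maps of degree zero. -/
theorem IsDirectSum.agr {n : ℕ} {Y : Fin n → C} {X : C} {ι : ∀ i, Y i ⟶ X} {π : ∀ i, X ⟶ Y i}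
    (h : IsDirectSum Y X ι π) :
    IsGradedDirectSum K (fun i => (⟨Y i⟩ : AGr K C)) ⟨X⟩ (fun i => AGr.classZero K _ _ (ι i))
      (fun i => AGr.classZero K _ _ (π i)) := by
  refine ⟨⟨fun i => ?_, fun i j hij => ?_, ?_⟩, fun i => AGr.classZero_mem_deg _,
    fun i => AGr.classZero_mem_deg _⟩
  · rw [← AGr.classZero_comp, h.1, AGr.classZero_id]
  · rw [← AGr.classZero_comp, h.2.1 i j hij, map_zero]
  · simp only [← AGr.classZero_comp]
    rw [← map_sum, h.2.2, AGr.classZero_id]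

/-- Finite biproducts present the biproduct object as a direct sum. -/
theorem exists_isDirectSum [Limits.HasFiniteBiproducts C] {n : ℕ} (Y : Fin n → C) :
    ∃ X ι π, IsDirectSum Y X ι π :=
  ⟨Limits.biproduct Y, Limits.biproduct.ι Y, Limits.biproduct.π Y,
    fun i => Limits.biproduct.ι_π_self Y i, fun _ _ hij => Limits.biproduct.ι_π_ne Y hij,
    Limits.biproduct.total⟩

/-- The degree zero part of the endomorphism ring in `A_gr(C)` is a quotient of the endomorphism
ring in `C`. -/
theorem isLocalRing_degZeroEnd (Y : C) [IsLocalRing (End Y)] :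
    IsLocalRing (degZeroEnd K (⟨Y⟩ : AGr K C)) := by
  have hne : (1 : degZeroEnd K (⟨Y⟩ : AGr K C)) ≠ 0 := by
    intro h
    have h' : AGr.classZero K Y Y (𝟙 Y) = 0 := congrArg Subtype.val h
    exact id_notMem_rad K Y (AGr.classZero_eq_zero.1 h')
  have : Nontrivial (degZeroEnd K (⟨Y⟩ : AGr K C)) := ⟨1, 0, hne⟩
  let φ : End Y →* degZeroEnd K (⟨Y⟩ : AGr K C) :=
    { toFun := fun f => ⟨AGr.classZero K Y Y f, AGr.classZero_mem_deg f⟩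
      map_one' := rfl
      map_mul' := fun f g => Subtype.ext (AGr.classZero_comp g f) }
  constructor
  rintro ⟨a, ha⟩ ⟨b, hb⟩ hab
  obtain ⟨f, rfl⟩ := AGr.exists_classZero ha
  have hb' : φ (1 - (show End Y from f)) = ⟨b, hb⟩ := by
    rw [eq_sub_of_add_eq' hab]
    exact Subtype.ext (map_sub (AGr.classZero K Y Y) (𝟙 Y) f)
  rcases IsLocalRing.isUnit_or_isUnit_of_add_one
    (add_sub_cancel (show End Y from f) 1) with h | h
  · exact Or.inl (h.map φ)
  · exact Or.inr (hb' ▸ h.map φ)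

theorem AGr.isGradedKrullSchmidt [Limits.HasFiniteBiproducts C] (hKS : IsKrullSchmidt C) :
    IsGradedKrullSchmidt K (AGr K C) := by
  refine ⟨fun n Y => ?_, fun X => ?_⟩
  · obtain ⟨X, ι, π, h⟩ := exists_isDirectSum fun i => (Y i).obj
    exact ⟨⟨X⟩, _, _, h.agr⟩
  · obtain ⟨n, Y, ⟨ι, π, h⟩, hloc⟩ := hKS X.obj
    exact ⟨n, fun i => ⟨Y i⟩, ⟨_, _, h.agr⟩, fun i =>
      have := hloc i
      isLocalRing_degZeroEnd (Y i)⟩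

end AssociatedGradedCategory

/-! ### Simple graded functors -/

section SimpleGraded

variable {K : Type w} [Field K] {D : Type u} [Category.{v} D] [Preadditive D] [Linear K D]
  [GradedCategory K D]

theorem GradedFunctor.iSup_deg (M : GradedFunctor K D) (X : D) : ⨆ j, M.deg X j = ⊤ :=
  (M.isInternal X).submodule_iSup_eq_top

theorem GradedFunctor.disjoint_deg (M : GradedFunctor K D) (X : D) (k : ℤ) :
    Disjoint (M.deg X k) (⨆ (j) (_ : j ≠ k), M.deg X j) :=
  (M.isInternal X).submodule_iSupIndep k

/-- The part of a graded functor in degrees at least `m`. -/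
def GradedFunctor.truncGE (M : GradedFunctor K D) (m : ℤ) : M.toMod.Sub :=
  fun X => ⨆ (j : ℤ) (_ : m ≤ j), M.deg X j

theorem GradedFunctor.deg_le_truncGE (M : GradedFunctor K D) {m j : ℤ} (h : m ≤ j) (X : D) :
    M.deg X j ≤ M.truncGE m X :=
  le_iSup₂_of_le j h le_rfl

theorem GradedFunctor.truncGE_isSubfunctor (hpos : IsPositivelyGraded K D)
    (M : GradedFunctor K D) (m : ℤ) : ModC.IsSubfunctor (M.truncGE m) := by
  intro X Y f y hy
  have hf : f ∈ ⨆ i, GradedCategory.deg (K := K) X Y i := by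
    rw [(GradedCategory.isInternal (K := K) X Y).submodule_iSup_eq_top]
    trivial
  induction hf using Submodule.iSup_induction' with
  | zero => rw [map_zero, LinearMap.zero_apply]; exact zero_mem _
  | add f g _ _ hf hg => rw [map_add, LinearMap.add_apply]; exact add_mem hf hg
  | mem i f hf =>
    by_cases hi : i < 0
    · rw [hpos X Y i hi, Submodule.mem_bot] at hf
      rw [hf, map_zero, LinearMap.zero_apply]
      exact zero_mem _
    · have h : M.truncGE m Y ≤ (M.truncGE m X).comap (M.toMod.act X Y f) :=
        iSup₂_le fun j hj z hz => M.deg_le_truncGE (by omega) X (M.act_mem hf hz)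
      exact h hy

theorem GradedFunctor.truncGE_graded (M : GradedFunctor K D) (m : ℤ) (X : D) :
    M.truncGE m X = ⨆ j : ℤ, M.truncGE m X ⊓ M.deg X j := by
  apply le_antisymm
  · exact iSup₂_le fun j hj =>
      le_iSup_of_le j (le_inf (M.deg_le_truncGE hj X) le_rfl)
  · exact iSup_le fun j => inf_le_left

/-- A simple graded functor over a positively graded category is concentrated in one degree. -/
theorem GradedFunctor.IsSimple.exists_deg_eq_top (hpos : IsPositivelyGraded K D)
    {M : GradedFunctor K D} (hM : M.IsSimple) : ∃ k : ℤ, ∀ X, M.deg X k = ⊤ := by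
  obtain ⟨⟨X, x, hx⟩, hsub⟩ := hM
  obtain ⟨k, hk⟩ : ∃ k, M.deg X k ≠ ⊥ := by
    by_contra! h
    have htop := M.iSup_deg X
    simp only [h, iSup_bot] at htop
    have hx' : x ∈ (⊤ : Submodule K (M.toMod.ev X)) := trivial
    rw [← htop, Submodule.mem_bot] at hx'
    exact hx hx'
  have hge : ∀ Y, M.truncGE k Y = ⊤ := by
    refine (hsub _ (M.truncGE_isSubfunctor hpos k) (M.truncGE_graded k)).resolve_left fun h => ?_
    exact hk (le_bot_iff.1 ((M.deg_le_truncGE le_rfl X).trans (h X).le))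
  have hgt : ∀ Y, M.truncGE (k + 1) Y = ⊥ := by
    refine (hsub _ (M.truncGE_isSubfunctor hpos _) (M.truncGE_graded _)).resolve_right fun h => ?_
    have hle : M.truncGE (k + 1) X ≤ ⨆ (j) (_ : j ≠ k), M.deg X j :=
      iSup₂_le fun j hj => le_iSup₂_of_le j (by omega) le_rfl
    rw [h X, top_le_iff] at hle
    have hdis := M.disjoint_deg X k
    rw [hle, disjoint_top] at hdis
    exact hk hdis
  refine ⟨k, fun Y => ?_⟩
  rw [eq_top_iff, ← hge Y]
  refine iSup₂_le fun j hj => ?_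
  rcases hj.eq_or_lt with rfl | hlt
  · exact le_rfl
  · exact ((M.deg_le_truncGE (Int.add_one_le_of_lt hlt) Y).trans (hgt Y).le).trans bot_le

theorem GradedFunctor.deg_eq_bot {M : GradedFunctor K D} {X : D} {k j : ℤ}
    (hk : M.deg X k = ⊤) (hj : j ≠ k) : M.deg X j = ⊥ := by
  have h := M.disjoint_deg X j
  have htop : ⨆ (i) (_ : i ≠ j), M.deg X i = ⊤ :=
    top_le_iff.1 (hk ▸ le_iSup₂_of_le k hj.symm le_rfl)
  rwa [htop, disjoint_top] at h

/-- A nonzero element generates a simple graded functor. -/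
theorem GradedFunctor.IsSimple.exists_act_eq {M : GradedFunctor K D} (hM : M.IsSimple) {k : ℤ}
    (hk : ∀ X, M.deg X k = ⊤) {X : D} {x : M.toMod.ev X} (hx : x ≠ 0) {Y : D}
    (y : M.toMod.ev Y) : ∃ f : Y ⟶ X, M.toMod.act Y X f x = y := by
  have hx' : x ∈ LinearMap.range ((M.toMod.act X X).flip x) := ⟨𝟙 X, M.toMod.act_id x⟩
  have hsub : ModC.IsSubfunctor fun Z => LinearMap.range ((M.toMod.act Z X).flip x) := by
    rintro Z W f _ ⟨g, rfl⟩
    exact ⟨f ≫ g, M.toMod.act_comp f g x⟩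
  have hgr : ∀ Z, LinearMap.range ((M.toMod.act Z X).flip x) =
      ⨆ j : ℤ, LinearMap.range ((M.toMod.act Z X).flip x) ⊓ M.deg Z j := fun Z =>
    le_antisymm (le_iSup_of_le k (by rw [hk Z, inf_top_eq])) (iSup_le fun j => inf_le_left)
  rcases hM.2 _ hsub hgr with h | h
  · rw [h X, Submodule.mem_bot] at hx'
    exact absurd hx' hx
  · have hy : y ∈ LinearMap.range ((M.toMod.act Y X).flip x) := by
      rw [h Y]
      trivial
    exact hy

end SimpleGraded

/-! ### Simple functors -/

section Simple

variable (K : Type w) [Field K] {C : Type u} [Category.{v} C] [Preadditive C] [Linear K C]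

/-- The functor `Hom(-, X) / rad(-, X)`. -/
def topRepr (X : C) : ModC K C where
  obj :=
    { obj := fun Y => ModuleCat.of K ((Y.unop ⟶ X) ⧸ rad K Y.unop X)
      map := fun {Y Z} f => ModuleCat.ofHom (Submodule.mapQ _ _ (Linear.leftComp K X f.unop)
        fun _ hg => rad_comp_left K f.unop hg)
      map_id := fun Y => by
        refine ModuleCat.hom_ext (Submodule.linearMap_qext _ (LinearMap.ext fun g => ?_))
        exact congrArg (Submodule.mkQ _) (Category.id_comp g)
      map_comp := fun {Y Z W} f f' => by
        refine ModuleCat.hom_ext (Submodule.linearMap_qext _ (LinearMap.ext fun g => ?_))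
        exact congrArg (Submodule.mkQ _) (Category.assoc f'.unop f.unop g) }
  property := by
    refine ⟨⟨fun {Y Z f f'} => ?_⟩, fun Y Z f c => ?_⟩
    · refine ModuleCat.hom_ext (Submodule.linearMap_qext _ (LinearMap.ext fun g => ?_))
      exact congrArg (Submodule.mkQ _) (Preadditive.add_comp _ _ _ f.unop f'.unop g)
    · refine ModuleCat.hom_ext (Submodule.linearMap_qext _ (LinearMap.ext fun g => ?_))
      exact congrArg (Submodule.mkQ _) (Linear.smul_comp _ _ _ c f g)

/-- The residue class of a map in `Hom(Y, X) / rad(Y, X)`. -/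
def topRepr.mk {Y X : C} (f : Y ⟶ X) : (topRepr K X).ev Y :=
  (rad K Y X).mkQ f

theorem topRepr.mk_surjective {Y X : C} (y : (topRepr K X).ev Y) : ∃ f, topRepr.mk K f = y :=
  Submodule.mkQ_surjective _ y

theorem topRepr.act_mk {Y Z X : C} (f : Y ⟶ Z) (g : Z ⟶ X) :
    (topRepr K X).act Y Z f (topRepr.mk K g) = topRepr.mk K (f ≫ g) := rfl

theorem topRepr.mk_eq_zero {Y X : C} {f : Y ⟶ X} : topRepr.mk K f = 0 ↔ f ∈ rad K Y X :=
  Submodule.Quotient.mk_eq_zero _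

theorem topRepr.mk_eq_mk {Y X : C} {f g : Y ⟶ X} :
    topRepr.mk K f = topRepr.mk K g ↔ f - g ∈ rad K Y X :=
  Submodule.Quotient.eq _

theorem topRepr.isSimple (X : C) [IsLocalRing (End X)] : (topRepr K X).IsSimple := by
  refine ⟨⟨X, topRepr.mk K (𝟙 X), fun h => id_notMem_rad K X ((topRepr.mk_eq_zero K).1 h)⟩,
    fun S hS => ?_⟩
  by_cases hbot : ∀ Y, S Y = ⊥
  · exact Or.inl hbot
  right
  push Not at hbot
  obtain ⟨Y, hY⟩ := hbot
  obtain ⟨y, hy, hy0⟩ := (Submodule.ne_bot_iff _).1 hY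
  obtain ⟨f, rfl⟩ := topRepr.mk_surjective K y
  obtain ⟨a, ha⟩ := exists_section_of_notMem_rad K fun h => hy0 ((topRepr.mk_eq_zero K).2 h)
  have h1 := hS X Y a _ hy
  rw [topRepr.act_mk, ha] at h1
  refine fun Z => eq_top_iff.2 fun z _ => ?_
  obtain ⟨g, rfl⟩ := topRepr.mk_surjective K z
  have h2 := hS Z X g _ h1
  rwa [topRepr.act_mk, Category.comp_id] at h2

theorem topRepr.radFilt_eq_bot (X Y : C) {i : ℕ} (hi : 1 ≤ i) :
    radFilt (topRepr K X) Y i = ⊥ := by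
  rw [eq_bot_iff]
  intro y hy
  obtain ⟨f, hf, rfl⟩ := (mem_radFilt_iff (s := topRepr.mk K (𝟙 X)) fun Z z => by
    obtain ⟨g, rfl⟩ := topRepr.mk_surjective K z
    exact ⟨g, by rw [topRepr.act_mk, Category.comp_id]⟩).1 hy
  rw [topRepr.act_mk, Category.comp_id, Submodule.mem_bot, topRepr.mk_eq_zero]
  exact radPow_le_rad K hi Y X hf

theorem topRepr.grDeg_eq_bot (X Y : C) {j : ℤ} (hj : j ≠ 0) :
    grDeg (radFilt (topRepr K X) Y) j = ⊥ := by
  rw [eq_bot_iff]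
  intro y hy
  obtain h | ⟨i, a, ha, rfl, rfl⟩ := exists_of_mem_grDeg hy
  · exact h
  · refine (GrMod.mk_eq_zero ha).2 ?_
    rw [topRepr.radFilt_eq_bot K X Y (by omega)] at ha
    rw [(Submodule.mem_bot K).1 ha]
    exact zero_mem _

theorem topRepr.mem_radFilt_zero {X Y : C} (f : Y ⟶ X) :
    topRepr.mk K f ∈ radFilt (topRepr K X) Y 0 :=
  (mem_radFilt_iff (s := topRepr.mk K (𝟙 X)) fun Z z => by
    obtain ⟨g, rfl⟩ := topRepr.mk_surjective K z
    exact ⟨g, by rw [topRepr.act_mk, Category.comp_id]⟩).2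
    ⟨f, trivial, by rw [topRepr.act_mk, Category.comp_id]⟩

/-- The class of a map `Y ⟶ X` in the degree zero part of `G(Hom(-, X) / rad(-, X))`. -/
def topRepr.grMk {Y X : C} (f : Y ⟶ X) : (agrMod (topRepr K X)).ev ⟨Y⟩ :=
  GrMod.mk (radFilt (topRepr K X) Y) 0 ⟨topRepr.mk K f, topRepr.mem_radFilt_zero K f⟩

theorem topRepr.grMk_eq_grMk {Y X : C} {f g : Y ⟶ X} :
    topRepr.grMk K f = topRepr.grMk K g ↔ f - g ∈ rad K Y X := by
  refine (GrMod.mk_eq_mk _ _).trans ?_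
  rw [topRepr.radFilt_eq_bot K X Y le_rfl, Submodule.mem_bot, ← topRepr.mk_eq_zero]
  rfl

end Simple

/-! ### Koszulity of the associated graded category -/

section Koszul

variable {K : Type w} [Field K] {C : Type u} [Category.{v} C] [Preadditive C] [Linear K C]

/-- The sum of the homogeneous parts of nonzero degree of `Hom(X, Y)` in `A_gr(C)`. -/
def AGr.nonzeroDegPart (X Y : AGr K C) : Submodule K (X ⟶ Y) :=
  ⨆ (i : ℤ) (_ : i ≠ 0), GradedCategory.deg (K := K) X Y i

theorem AGr.exists_sub_classZero_mem {X Y : C} (f : (⟨X⟩ : AGr K C) ⟶ ⟨Y⟩) :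
    ∃ f₀ : X ⟶ Y, f - AGr.classZero K X Y f₀ ∈ AGr.nonzeroDegPart (K := K) ⟨X⟩ ⟨Y⟩ := by
  have hf : f ∈ ⨆ i, GradedCategory.deg (K := K) (⟨X⟩ : AGr K C) ⟨Y⟩ i := by
    rw [(GradedCategory.isInternal (K := K) (⟨X⟩ : AGr K C) ⟨Y⟩).submodule_iSup_eq_top]
    trivial
  induction hf using Submodule.iSup_induction' with
  | zero => exact ⟨0, by rw [map_zero, sub_zero]; exact zero_mem _⟩
  | add f g _ _ hf hg =>
    obtain ⟨f₀, hf⟩ := hf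
    obtain ⟨g₀, hg⟩ := hg
    exact ⟨f₀ + g₀, by rw [map_add, add_sub_add_comm]; exact add_mem hf hg⟩
  | mem i f hf =>
    by_cases hi : i = 0
    · subst hi
      obtain ⟨f₀, rfl⟩ := AGr.exists_classZero hf
      exact ⟨f₀, by rw [sub_self]; exact zero_mem _⟩
    · refine ⟨0, ?_⟩
      rw [map_zero, sub_zero]
      exact Submodule.mem_iSup_of_mem i (Submodule.mem_iSup_of_mem hi hf)

/-- Maps of nonzero degree act as zero on a graded functor concentrated in one degree. -/
theorem GradedFunctor.act_eq_act {M : GradedFunctor K (AGr K C)} {X Y : AGr K C} {k : ℤ}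
    {y : M.toMod.ev Y} (hy : y ∈ M.deg Y k) (hX : ∀ j ≠ k, M.deg X j = ⊥) {f f' : X ⟶ Y}
    (hf : f - f' ∈ AGr.nonzeroDegPart (K := K) X Y) :
    M.toMod.act X Y f y = M.toMod.act X Y f' y := by
  have h : AGr.nonzeroDegPart (K := K) X Y ≤ LinearMap.ker ((M.toMod.act X Y).flip y) := by
    refine iSup₂_le fun i hi f hf => ?_
    have h := M.act_mem hf hy
    rwa [hX _ (by omega), Submodule.mem_bot] at h
  have h0 : M.toMod.act X Y (f - f') y = 0 := h hf
  rwa [map_sub, LinearMap.sub_apply, sub_eq_zero] at h0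

/-- A simple graded functor over `A_gr(C)` has a nonzero value at an object with local endomorphism
ring in `C`. -/
theorem GradedFunctor.IsSimple.exists_isLocalRing (hKS : IsKrullSchmidt C)
    {S : GradedFunctor K (AGr K C)} (hS : S.IsSimple) :
    ∃ (X : C) (s : S.toMod.ev ⟨X⟩), s ≠ 0 ∧ IsLocalRing (End X) := by
  obtain ⟨⟨⟨X⟩, s, hs⟩, -⟩ := hS
  obtain ⟨n, Y, ⟨ι, π, h⟩, hloc⟩ := hKS X
  obtain ⟨i, hi⟩ : ∃ i, S.toMod.act ⟨Y i⟩ ⟨X⟩ (AGr.classZero K _ _ (ι i)) s ≠ 0 := by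
    by_contra! h0
    apply hs
    rw [← S.toMod.act_id s, ← (h.agr (K := K)).1.2.2, map_sum, LinearMap.sum_apply]
    refine Finset.sum_eq_zero fun i _ => ?_
    rw [ModC.act_comp, h0, map_zero]
  exact ⟨Y i, _, hi, hloc i⟩

/-- A simple graded functor `S` over `A_gr(C)` is, up to shift, isomorphic to `G` of a simple
functor `Hom(-, X) / rad(-, X)`; a linear resolution of the latter resolves a shift of `S`. -/
theorem GradedFunctor.IsSimple.isLinear_shift {S : GradedFunctor K (AGr K C)} (hS : S.IsSimple)
    {k : ℤ} (hk : ∀ X, S.deg X k = ⊤) {X : C} [IsLocalRing (End X)] {s : S.toMod.ev ⟨X⟩}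
    (hs : s ≠ 0) (hlin : IsLinear (assocGraded (topRepr K X))) : IsLinear (S.shift k) := by
  obtain ⟨P, d, ε, hd, hε, hex⟩ := hlin
  have hclass : ∀ {Y : C} {g : Y ⟶ X},
      S.toMod.act ⟨Y⟩ ⟨X⟩ (AGr.classZero K Y X g) s = 0 ↔ g ∈ rad K Y X := by
    intro Y g
    constructor
    · intro h
      by_contra hg
      obtain ⟨a, ha⟩ := exists_section_of_notMem_rad K hg
      apply hs
      rw [← S.toMod.act_id s, ← AGr.classZero_id, ← ha, AGr.classZero_comp, ModC.act_comp, h,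
        map_zero]
    · intro hg
      rw [AGr.classZero_eq_zero.2 hg, map_zero, LinearMap.zero_apply]
  obtain ⟨h, hh⟩ : ∃ h : (P 0).obj ⟶ X,
      ModC.app ε (P 0) (𝟙 (P 0)) = topRepr.grMk K h := by
    have h1 := hε (P 0) 0 (𝟙 (P 0)) (GradedCategory.id_mem (P 0))
    obtain h2 | ⟨i, a, ha, hi, h2⟩ := exists_of_mem_grDeg h1
    · refine ⟨0, h2.trans (((GrMod.mk_eq_zero _).2 ?_).symm)⟩
      rw [show topRepr.mk K (0 : (P 0).obj ⟶ X) = 0 from map_zero _]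
      exact zero_mem _
    · obtain rfl : i = 0 := by exact_mod_cast hi.symm
      obtain ⟨f, rfl⟩ := topRepr.mk_surjective K a
      exact ⟨f, h2⟩
  obtain ⟨s', hs'⟩ : ∃ s', S.toMod.act (P 0) ⟨X⟩ (AGr.classZero K _ X h) s = s' := ⟨_, rfl⟩
  -- `ε` and the map given by `s'` only depend on the degree zero part, in the same way
  have key : ∀ (Y : C) (f : (⟨Y⟩ : AGr K C) ⟶ P 0), ∃ g : Y ⟶ X,
      ModC.app ε ⟨Y⟩ f = topRepr.grMk K g ∧
        S.toMod.act ⟨Y⟩ (P 0) f s' = S.toMod.act ⟨Y⟩ ⟨X⟩ (AGr.classZero K Y X g) s := by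
    intro Y f
    obtain ⟨f₀, hf₀⟩ := AGr.exists_sub_classZero_mem f
    refine ⟨f₀ ≫ h, ?_, ?_⟩
    · have h1 := (assocGraded (topRepr K X)).act_eq_act (k := 0)
        (mk_mem_grDeg (radFilt (topRepr K X) (P 0).obj) 0 ⟨_, topRepr.mem_radFilt_zero K h⟩)
        (fun j hj => topRepr.grDeg_eq_bot K X Y hj) hf₀
      refine (ModC.app_eq_act (F := agrMod (topRepr K X)) ε f).trans ?_
      refine (congrArg ((agrMod (topRepr K X)).act ⟨Y⟩ (P 0) f) hh).trans ?_
      exact h1.trans (agrAct_mk (topRepr K X) (i := 0) trivial (topRepr.mem_radFilt_zero K h))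
    · have h1 := S.act_eq_act (k := k) (show s' ∈ S.deg (P 0) k by rw [hk]; trivial)
        (fun j hj => S.deg_eq_bot (hk _) hj) hf₀
      rw [h1, AGr.classZero_comp, ModC.act_comp, hs']
  refine ⟨P, d, S.toMod.ofElement s', hd, ?_, ?_⟩
  · intro Y j x hx
    have h1 := S.act_mem hx (show s' ∈ S.deg (P 0) k by rw [hk]; trivial)
    rw [add_comm] at h1
    exact h1
  · rintro ⟨Y⟩
    obtain ⟨hsurj, hex0, hexd⟩ := hex ⟨Y⟩
    refine ⟨fun y => ?_, fun f => ?_, hexd⟩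
    · obtain ⟨c, rfl⟩ := hS.exists_act_eq hk hs y
      obtain ⟨g, hg⟩ : ∃ g : Y ⟶ X, S.toMod.act ⟨Y⟩ ⟨X⟩ c s =
          S.toMod.act ⟨Y⟩ ⟨X⟩ (AGr.classZero K Y X g) s := by
        obtain ⟨g, hg⟩ := AGr.exists_sub_classZero_mem c
        have h1 := S.act_eq_act (k := k) (show s ∈ S.deg ⟨X⟩ k by rw [hk]; trivial)
          (fun j hj => S.deg_eq_bot (hk _) hj) hg
        exact ⟨g, h1⟩
      obtain ⟨f, hf⟩ := hsurj (topRepr.grMk K g)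
      obtain ⟨g', hg', hgs'⟩ := key Y f
      refine ⟨f, hgs'.trans ?_⟩
      rw [hg, ← sub_eq_zero, ← LinearMap.sub_apply, ← map_sub, ← map_sub, hclass,
        ← topRepr.grMk_eq_grMk, ← hg', hf]
    · rw [← hex0 f]
      obtain ⟨g, hg, hgs⟩ := key Y f
      change S.toMod.act ⟨Y⟩ (P 0) f s' = 0 ↔ ModC.app ε ⟨Y⟩ f = 0
      rw [hgs, hclass, hg]
      refine Iff.trans ?_ (GrMod.mk_eq_zero _).symm
      rw [topRepr.radFilt_eq_bot K X Y le_rfl, Submodule.mem_bot, topRepr.mk_eq_zero]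

end Koszul

end KoszulCat

open KoszulCat in
theorem mainTheorem3 (K : Type w) [Field K] (C : Type u) [Category.{v} C] [Preadditive C]
    [Linear K C] [Limits.HasFiniteBiproducts C] [IsIdempotentComplete C]
    (hKS : IsKrullSchmidt C) (hfin : IsLocallyRadicalFinite K C) :
    (IsPositivelyGraded K (AGr K C) ∧ IsGradedKrullSchmidt K (AGr K C) ∧
      IsLocallyFinite K (AGr K C)) ∧
    (∀ F : ModC K C, IsWeaklyKoszul F → IsLinear (assocGraded F)) ∧
    (IsWeaklyKoszulCategory K C → IsKoszulCategory K (AGr K C)) := by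
  have hpos := AGr.isPositivelyGraded K C
  have hgKS := AGr.isGradedKrullSchmidt (K := K) hKS
  have hlf := AGr.isLocallyFinite K C hfin
  refine ⟨⟨hpos, hgKS, hlf⟩, fun F hF => hF.isLinear_assocGraded hKS, ?_⟩
  rintro ⟨-, -, -, hsimple⟩
  refine ⟨hpos, hgKS, hlf, fun S hS => ?_⟩
  obtain ⟨k, hk⟩ := hS.exists_deg_eq_top hpos
  obtain ⟨X, s, hs, hloc⟩ := hS.exists_isLocalRing hKS
  exact ⟨k, hS.isLinear_shift hk hs
    ((hsimple _ (topRepr.isSimple K X)).isLinear_assocGraded hKS)⟩
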